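/- **Theorem (Soundness).** *Rewrite theories.* All signatures are many-sorted, with countably many variables $X_s$ of each sort $s$ and with ground terms of each sort. A rewrite theory is $\mathcal R=(\Sigma,E\cup B,R)$, where $E$ is a set of conditional equations $u=v\ \mathit{if}\ \bigwedge_i u_i=v_i$, $B$ is a set of unconditional, regular and linear equations, and $R$ is a set of conditional rules $l\to r\ \mathit{if}\ \phi$ with $l,r$ of the same sort and $\phi$ a quantifier-free $\Sigma$-formula (extra variables in $r,\phi$ are allowed). The oriented equations $\vec E$ are convergent modulo $B$ (strictly coherent, confluent, operationally terminating; conditions $u_i=v_i$ are evaluated by joinability modulo $B$), and $R$ is ground coherent with $E$ modulo $B$. Write $t!$ for the $\vec E,B$-canonical form of $t$, and $E\cup B\models\phi\sigma$, for ground $\sigma$, for truth of $\phi\sigma$ in the initial algebra $T_{\Sigma/E\cup B}$. The relation $t\to_{R,B}t'$ on ground terms holds iff $t|_p=_B l\sigma$, $t'=t[r\sigma]_p$ and $E\cup B\models\phi\sigma$ for some position $p$, rule $l\to r\ \mathit{if}\ \phi$ in $R$ and ground $\sigma$. The states of the canonical reachability model $\mathcal C_{\mathcal R}$ are the $B$-classes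 $[u]$ of ground $\vec E,B$-irreducible terms $u$ (the elements of the canonical term algebra $C_{\Sigma/E,B}$), and $[u]\to_{\mathcal R}[v]$ iff $u\to_{R,B}u'$ and $[u'!]=[v]$ for some $u'$. *Topmost requirements.* (1) There are a sort $\mathit{State}$ and a constructor decomposition $(\Omega,B_\Omega,\vec E_\Omega)$ of $(\Sigma,B,\vec E)$, that is: $\Omega\subseteq\Sigma$ has the same sorts, $E_\Omega\subseteq E$ and $B_\Omega\subseteq B$ are over $\Omega$, $\vec E_\Omega$ is convergent modulo $B_\Omega$; the two theories agree on $\Omega$-terms about equality modulo axioms and about being in canonical form, and $C_{\Omega/E_\Omega,B_\Omega}=C_{\Sigma/E,B}|_\Omega$; the canonical form of every ground $\Sigma$-term is a ground $\Omega$-term, and ground $\Omega$-terms are closed under $=_B$. Moreover $\mathrm{vars}(u)=\mathrm{vars}(u!)$ for each $u\in T_\Omega(X)_{\mathit{State}}$, $B_\Omega$ is linear and regular, and $E_\Omega\cup B_\Omega$-unification is finitary. (2) In every rule, $l\in T_\Omega(X)$, and $l,r$ have sort $\mathit{State}$; no $u\in T_\Omega(X)_{\mathit{State}}$ has a proper subterm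 in $T_\Omega(X)_{\mathit{State}}$. In addition, $r\in T_\Omega(X)$ for every rule. *Formulas.* A pattern $u\mid\varphi$ consists of $u\in T_\Omega(X)_{\mathit{State}}$ and a quantifier-free $\Sigma$-formula $\varphi$; $[\![u\mid\varphi]\!]$ is the set of states $[(u\rho)!]$ with $\rho$ a ground $\Omega$-substitution such that $E\cup B\models\varphi\rho$; a finite disjunction denotes the union. A reachability formula is $u\mid\varphi\to^{\circledast}\bigvee_i v_i\mid\psi_i$ (finite disjunction) with $\mathrm{vars}(\psi_i)\subseteq\mathrm{vars}(v_i)\cup\mathrm{vars}(u\mid\varphi)$; its parameters are $Y=\mathrm{vars}(u\mid\varphi)\cap\mathrm{vars}(\bigvee_i v_i\mid\psi_i)$. Let $T=\bigvee_j t_j\mid\chi_j$ be a finite disjunction of patterns, $\mathrm{vars}(\chi_j)\subseteq\mathrm{vars}(t_j)$, such that every state in $[\![T]\!]$ is terminating, i.e. has no $\to_{\mathcal R}$-successor. $\mathcal R\models^\forall_T u\mid\varphi\to^{\circledast}\bigvee_i v_i\mid\psi_i$ means: for each $\rho\in[Y\to T_\Omega]$ and each sequence $[w_0]\to_{\mathcal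 R}\cdots\to_{\mathcal R}[w_n]$ ($n\ge0$) with $[w_0]\in[\![(u\mid\varphi)\rho]\!]$ and $[w_n]\in[\![T]\!]$, there are $k\le n$ and $i$ with $[w_k]\in[\![(v_i\mid\psi_i)\rho]\!]$. *Inference system.* Sequents $[\mathcal A,\mathcal C]\vdash_T F$ (with $\mathcal A,\mathcal C$ sets of reachability formulas) are derived by two rules. Substitutions below are over $\Omega$. Rules of $R$, disjuncts of $T$ and axioms are always renamed, by sort-preserving bijections of the variables, so as to share no variable with the current goal. Complete sets of unifiers are complete for the variables of the goal and of the renamed rule or disjunct: each unifier is on these variables, modulo $E_\Omega\cup B_\Omega$, an instance of one in the set. - **Step$^\forall$+Subsumption.** Take a finite set $M$ of pairs $(i,\beta)$ with $u=_{E_\Omega\cup B_\Omega}v_i\beta$, where $\beta$ instantiates only variables in $\mathrm{vars}(v_i)\setminus\mathrm{vars}(u\mid\varphi)$, and put $\varphi'=\varphi\wedge\bigwedge_{(i,\beta)\in M}\neg\psi_i\beta$. From the premises $[\mathcal A\cup\mathcal C,\emptyset]\vdash_T(r\mid\varphi'\wedge\phi)\alpha\to^{\circledast}\bigvee_i(v_i\mid\psi_i)\alpha$,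 one for each rule $l\to r\ \mathit{if}\ \phi$ in $R$ and each $\alpha$ in a complete set of $E_\Omega\cup B_\Omega$-unifiers of $u,l$ with $(\varphi'\wedge\phi)\alpha$ satisfiable in $T_{\Sigma/E\cup B}$, infer $[\mathcal A,\mathcal C]\vdash_T u\mid\varphi\to^{\circledast}\bigvee_i v_i\mid\psi_i$; provided that, for each $j$, $(\varphi'\wedge\chi_j)\gamma$ is unsatisfiable in $T_{\Sigma/E\cup B}$ for all $\gamma$ in a complete set of unifiers of $u,t_j$, and that, for each premise, $\mathrm{vars}((u\mid\varphi)\alpha)\cap\mathrm{vars}(\bigvee_i(v_i\mid\psi_i)\alpha)=\mathrm{vars}((r\mid\varphi'\wedge\phi)\alpha)\cap\mathrm{vars}(\bigvee_i(v_i\mid\psi_i)\alpha)$. - **Axiom.** Let $u'\mid\varphi'\to^{\circledast}\bigvee_j v'_j\mid\psi'_j$ be a (renamed) element of $\mathcal A$ and let $\alpha$ instantiate only variables of $u'\mid\varphi'$, by terms that contain no variable of this axiom, such that $u=_{E_\Omega\cup B_\Omega}u'\alpha$ and $T_{\Sigma/E\cup B}\models\varphi\Rightarrow\varphi'\alpha$.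 From $[\mathcal A,\emptyset]\vdash_T v'_j\alpha\mid\varphi\wedge\psi'_j\alpha\to^{\circledast}\bigvee_i v_i\mid\psi_i$ for all $j$ infer $[\mathcal A,\emptyset]\vdash_T u\mid\varphi\to^{\circledast}\bigvee_i v_i\mid\psi_i$; provided that, for each $j$, $\mathrm{vars}(u\mid\varphi)\cap\mathrm{vars}(\bigvee_i v_i\mid\psi_i)=\mathrm{vars}(v'_j\alpha\mid\varphi\wedge\psi'_j\alpha)\cap\mathrm{vars}(\bigvee_i v_i\mid\psi_i)$. *Claim.* Let $\mathcal R$ satisfy the above requirements and let $\mathcal C$ be a finite set of reachability formulas. If $[\emptyset,\mathcal C]\vdash_T F$ is derivable for every $F\in\mathcal C$, then $\mathcal R\models^\forall_T F$ for every $F\in\mathcal C$. -/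

import Mathlib

universe u v

namespace CRL

/-! ### Many-sorted signatures, terms and substitutions -/

/-- A many-sorted signature: a type of sorts and, for each arity `w` and each sort `s`, the
function symbols `f : w → s`. -/
structure Signature where
  Srt : Type u
  Op : List Srt → Srt → Type v

/-- A subsignature with the same sorts, given by the function symbols that belong to it. -/
abbrev SubSig (Sg : Signature.{u, v}) := ∀ ⦃w : List Sg.Srt⦄ ⦃s : Sg.Srt⦄, Sg.Op w s → Prop

/-- The whole signature, as a subsignature of itself. -/
def SubSig.full (Sg : Signature.{u, v}) : SubSig Sg := fun _ _ _ => True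

/-- Variables: countably many for each sort, with different sorts having disjoint variables. -/
abbrev Var (Sg : Signature.{u, v}) := Sg.Srt × ℕ

/-- The terms `T_Σ(X)_s` of sort `s`. -/
inductive Term (Sg : Signature.{u, v}) : Sg.Srt → Type (max u v)
  | var (s : Sg.Srt) (n : ℕ) : Term Sg s
  | app {w : List Sg.Srt} {s : Sg.Srt} (f : Sg.Op w s)
      (args : ∀ i : Fin w.length, Term Sg (w.get i)) : Term Sg s

/-- Sort-preserving substitutions of terms for variables. -/
abbrev Subst (Sg : Signature.{u, v}) := ∀ s : Sg.Srt, ℕ → Term Sg s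

variable {Sg : Signature.{u, v}}

/-- The list of variable occurrences of a term, from left to right. -/
def Term.varList : ∀ {s : Sg.Srt}, Term Sg s → List (Var Sg)
  | _, .var s n => [(s, n)]
  | _, .app _ args => (List.ofFn fun i => (args i).varList).flatten

/-- The set of variables of a term. -/
def Term.vars {s : Sg.Srt} (t : Term Sg s) : Set (Var Sg) := {x | x ∈ t.varList}

/-- Ground terms. -/
def Term.IsGround {s : Sg.Srt} (t : Term Sg s) : Prop := t.vars = ∅

/-- `t.Over F`: all function symbols of `t` belong to the subsignature `F`, i.e. `t ∈ T_F(X)`. -/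
def Term.Over (F : SubSig Sg) : ∀ {s : Sg.Srt}, Term Sg s → Prop
  | _, .var _ _ => True
  | _, .app f args => F f ∧ ∀ i, (args i).Over F

/-- The homomorphic extension `t ↦ tσ` of a substitution. -/
def Term.subst (σ : Subst Sg) : ∀ {s : Sg.Srt}, Term Sg s → Term Sg s
  | _, .var s n => σ s n
  | _, .app f args => .app f fun i => (args i).subst σ

/-- `Subterm a t`: `a = t|_p` for some position `p` of `t`. -/
inductive Subterm {s' : Sg.Srt} (a : Term Sg s') : ∀ {s : Sg.Srt}, Term Sg s → Prop
  | refl : Subterm a a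
  | arg {w : List Sg.Srt} {s : Sg.Srt} (f : Sg.Op w s)
      (args : ∀ i : Fin w.length, Term Sg (w.get i)) (i : Fin w.length) :
      Subterm a (args i) → Subterm a (Term.app f args)

/-- The substitution takes values in `T_F(X)`. -/
def Subst.Over (F : SubSig Sg) (σ : Subst Sg) : Prop := ∀ s n, (σ s n).Over F

/-- The substitution takes values in ground terms. -/
def Subst.IsGround (σ : Subst Sg) : Prop := ∀ s n, (σ s n).IsGround

/-- The substitution is the identity outside the set `D` of variables. -/
def Subst.IdOff (σ : Subst Sg) (D : Set (Var Sg)) : Prop :=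
  ∀ s n, (s, n) ∉ D → σ s n = .var s n

/-- Bijective sort-preserving renamings of variables. -/
abbrev Renaming (Sg : Signature.{u, v}) := Sg.Srt → Equiv.Perm ℕ

/-- A renaming as a substitution. -/
def Renaming.toSubst (π : Renaming Sg) : Subst Sg := fun s n => .var s (π s n)

/-! ### Quantifier-free formulas, equations, rewrite rules -/

/-- Quantifier-free formulas over the function symbols and equality. -/
inductive QF (Sg : Signature.{u, v}) : Type (max u v)
  | top : QF Sg
  | eq {s : Sg.Srt} (a b : Term Sg s) : QF Sg
  | neg (φ : QF Sg) : QF Sg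
  | and (φ ψ : QF Sg) : QF Sg
  | or (φ ψ : QF Sg) : QF Sg

/-- The variables of a quantifier-free formula. -/
def QF.vars : QF Sg → Set (Var Sg)
  | .top => ∅
  | .eq a b => a.vars ∪ b.vars
  | .neg φ => φ.vars
  | .and φ ψ => φ.vars ∪ ψ.vars
  | .or φ ψ => φ.vars ∪ ψ.vars

/-- Applying a substitution to a quantifier-free formula. -/
def QF.subst (σ : Subst Sg) : QF Sg → QF Sg
  | .top => .top
  | .eq a b => .eq (a.subst σ) (b.subst σ)
  | .neg φ => .neg (φ.subst σ)
  | .and φ ψ => .and (φ.subst σ) (ψ.subst σ)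
  | .or φ ψ => .or (φ.subst σ) (ψ.subst σ)

/-- An unconditional equation `lhs = rhs` between terms of sort `s`. -/
structure Eqn (Sg : Signature.{u, v}) (s : Sg.Srt) where
  lhs : Term Sg s
  rhs : Term Sg s

/-- A conditional equation `lhs = rhs if u₁ = v₁ ∧ … ∧ uₙ = vₙ`. -/
structure CondEqn (Sg : Signature.{u, v}) (s : Sg.Srt) where
  lhs : Term Sg s
  rhs : Term Sg s
  conds : List (Σ s' : Sg.Srt, Eqn Sg s')

/-- A conditional rewrite rule `lhs → rhs if cond`. The right-hand side and the condition may
have variables that do not occur in the left-hand side. -/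
structure RwRule (Sg : Signature.{u, v}) (s : Sg.Srt) where
  lhs : Term Sg s
  rhs : Term Sg s
  cond : QF Sg

def RwRule.vars {s : Sg.Srt} (r : RwRule Sg s) : Set (Var Sg) :=
  r.lhs.vars ∪ r.rhs.vars ∪ r.cond.vars

def RwRule.subst {s : Sg.Srt} (r : RwRule Sg s) (σ : Subst Sg) : RwRule Sg s :=
  ⟨r.lhs.subst σ, r.rhs.subst σ, r.cond.subst σ⟩

/-- All terms of a conditional equation are terms over the subsignature `F`. -/
def CondEqn.Over (F : SubSig Sg) {s : Sg.Srt} (e : CondEqn Sg s) : Prop :=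
  e.lhs.Over F ∧ e.rhs.Over F ∧ ∀ c ∈ e.conds, c.2.lhs.Over F ∧ c.2.rhs.Over F

/-- Both sides of the equation have the same variables. -/
def Eqn.Regular {s : Sg.Srt} (e : Eqn Sg s) : Prop := e.lhs.vars = e.rhs.vars

/-- Neither side of the equation has a repeated variable. -/
def Eqn.Linear {s : Sg.Srt} (e : Eqn Sg s) : Prop := e.lhs.varList.Nodup ∧ e.rhs.varList.Nodup

/-! ### Equational deduction -/

/-- Provable equality of terms of `T_F(X)` from a set `Ax` of conditional equations, in
many-sorted equational logic over the signature `F`. -/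
inductive ProvEq (F : SubSig Sg) (Ax : ∀ s : Sg.Srt, Set (CondEqn Sg s)) :
    ∀ {s : Sg.Srt}, Term Sg s → Term Sg s → Prop
  | refl {s : Sg.Srt} (t : Term Sg s) : t.Over F → ProvEq F Ax t t
  | symm {s : Sg.Srt} {t t' : Term Sg s} : ProvEq F Ax t t' → ProvEq F Ax t' t
  | trans {s : Sg.Srt} {t t' t'' : Term Sg s} :
      ProvEq F Ax t t' → ProvEq F Ax t' t'' → ProvEq F Ax t t''
  | congr {w : List Sg.Srt} {s : Sg.Srt} (f : Sg.Op w s)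
      (args args' : ∀ i : Fin w.length, Term Sg (w.get i)) : F f →
      (∀ i, ProvEq F Ax (args i) (args' i)) → ProvEq F Ax (.app f args) (.app f args')
  | ax {s : Sg.Srt} (e : CondEqn Sg s) (σ : Subst Sg) : e ∈ Ax s → e.Over F → σ.Over F →
      (∀ c ∈ e.conds, ProvEq F Ax (c.2.lhs.subst σ) (c.2.rhs.subst σ)) →
      ProvEq F Ax (e.lhs.subst σ) (e.rhs.subst σ)

/-- An equational theory `(F, E ∪ B)` presented as a triple `(F, B, E)`: a signature `F` (a
subsignature of the ambient one), conditional equations `E` that will be oriented from left to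
right, and unconditional axioms `B` modulo which one rewrites. -/
structure EqTheory (Sg : Signature.{u, v}) where
  sig : SubSig Sg
  E : ∀ s : Sg.Srt, Set (CondEqn Sg s)
  B : ∀ s : Sg.Srt, Set (Eqn Sg s)

namespace EqTheory

variable (T : EqTheory Sg)

/-- The axioms `B`, as conditional equations with an empty condition. -/
def axB : ∀ s : Sg.Srt, Set (CondEqn Sg s) :=
  fun s => {e | ∃ b ∈ T.B s, e = ⟨b.lhs, b.rhs, []⟩}

/-- `t =_B t'`. -/
def EqB {s : Sg.Srt} (t t' : Term Sg s) : Prop := ProvEq T.sig T.axB t t'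

/-- `t =_{E ∪ B} t'`. -/
def EqEB {s : Sg.Srt} (t t' : Term Sg s) : Prop :=
  ProvEq T.sig (fun s => T.E s ∪ T.axB s) t t'

/-- All equations of the theory are equations over its signature. -/
def WellFormed : Prop :=
  (∀ s, ∀ e ∈ T.E s, e.Over T.sig) ∧ (∀ s, ∀ e ∈ T.axB s, e.Over T.sig)

/-! ### Rewriting with the oriented equations modulo the axioms -/

mutual
/-- The one-step relation `t →_{E,B} t'` on `T_F(X)`: for some position `p`, some equation
`l = r if ⋀ uᵢ = vᵢ` of `E` and some substitution `σ`, `t|_p =_B lσ`, `t' = t[rσ]_p` and all the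
conditions `uᵢσ ↓ vᵢσ` hold. -/
inductive EStep : ∀ {s : Sg.Srt}, Term Sg s → Term Sg s → Prop
  | root {s : Sg.Srt} (t : Term Sg s) (e : CondEqn Sg s) (σ : Subst Sg) : e ∈ T.E s →
      e.Over T.sig → σ.Over T.sig → T.EqB t (e.lhs.subst σ) →
      (∀ c ∈ e.conds, EJoin (c.2.lhs.subst σ) (c.2.rhs.subst σ)) → EStep t (e.rhs.subst σ)
  | arg {w : List Sg.Srt} {s : Sg.Srt} (f : Sg.Op w s)
      (args : ∀ i : Fin w.length, Term Sg (w.get i)) (i : Fin w.length)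
      (t' : Term Sg (w.get i)) : T.sig f → (∀ j, (args j).Over T.sig) → EStep (args i) t' →
      EStep (.app f args) (.app f (Function.update args i t'))

/-- `a ↓ b`: there are `a →*_{E,B} c` and `b →*_{E,B} d` with `c =_B d`. -/
inductive EJoin : ∀ {s : Sg.Srt}, Term Sg s → Term Sg s → Prop
  | eqB {s : Sg.Srt} {a b : Term Sg s} : T.EqB a b → EJoin a b
  | left {s : Sg.Srt} {a a' b : Term Sg s} : EStep a a' → EJoin a' b → EJoin a b
  | right {s : Sg.Srt} {a b b' : Term Sg s} : EStep b b' → EJoin a b' → EJoin a b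
end

/-- `t →*_{E,B} t'`. -/
def ESteps {s : Sg.Srt} (t t' : Term Sg s) : Prop := Relation.ReflTransGen T.EStep t t'

/-- No `E,B`-rewrite step is possible from `t`, i.e. `t` is in canonical form. -/
def Irred {s : Sg.Srt} (t : Term Sg s) : Prop := ∀ t', ¬ T.EStep t t'

/-- `n` is an `E,B`-canonical form `t!` of `t` (for convergent `E` it is unique up to `=_B`). -/
def IsNF {s : Sg.Srt} (t n : Term Sg s) : Prop := T.ESteps t n ∧ T.Irred n

/-- `t =_B u` and `t →_{E,B} t'` imply `u →_{E,B} u'` for some `u' =_B t'`. -/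
def StrictlyCoherent : Prop :=
  ∀ (s : Sg.Srt) (t u t' : Term Sg s), T.EqB t u → T.EStep t t' →
    ∃ u', T.EStep u u' ∧ T.EqB t' u'

/-- Confluence modulo `B`. -/
def Confluent : Prop :=
  ∀ (s : Sg.Srt) (t a b : Term Sg s), t.Over T.sig → T.ESteps t a → T.ESteps t b →
    ∃ a' b', T.ESteps a a' ∧ T.ESteps b b' ∧ T.EqB a' b'

/-- `ECall t t'`: the evaluation of `t` leads to the evaluation of `t'`, either because `t`
rewrites to `t'`, or because an equation applies to a subterm of `t` and `t'` is an instance of a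
side of one of its conditions, all conditions to the left of which have been solved. -/
inductive ECall : (Σ s : Sg.Srt, Term Sg s) → (Σ s : Sg.Srt, Term Sg s) → Prop
  | step {s : Sg.Srt} {t t' : Term Sg s} : T.EStep t t' → ECall ⟨s, t⟩ ⟨s, t'⟩
  | condLeft {s s' : Sg.Srt} (t : Term Sg s) (a : Term Sg s') (e : CondEqn Sg s') (σ : Subst Sg)
      (pre post : List (Σ s'' : Sg.Srt, Eqn Sg s'')) (c : Σ s'' : Sg.Srt, Eqn Sg s'') :
      t.Over T.sig → Subterm a t → e ∈ T.E s' → e.Over T.sig → σ.Over T.sig →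
      T.EqB a (e.lhs.subst σ) → e.conds = pre ++ c :: post →
      (∀ d ∈ pre, T.EJoin (d.2.lhs.subst σ) (d.2.rhs.subst σ)) →
      ECall ⟨s, t⟩ ⟨c.1, c.2.lhs.subst σ⟩
  | condRight {s s' : Sg.Srt} (t : Term Sg s) (a : Term Sg s') (e : CondEqn Sg s') (σ : Subst Sg)
      (pre post : List (Σ s'' : Sg.Srt, Eqn Sg s'')) (c : Σ s'' : Sg.Srt, Eqn Sg s'') :
      t.Over T.sig → Subterm a t → e ∈ T.E s' → e.Over T.sig → σ.Over T.sig →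
      T.EqB a (e.lhs.subst σ) → e.conds = pre ++ c :: post →
      (∀ d ∈ pre, T.EJoin (d.2.lhs.subst σ) (d.2.rhs.subst σ)) →
      ECall ⟨s, t⟩ ⟨c.1, c.2.rhs.subst σ⟩

/-- Operational termination: no infinite rewriting, and no infinite descent into the evaluation
of conditions. -/
def OperationallyTerminating : Prop := WellFounded fun a b => T.ECall b a

/-- The oriented equations `E` are convergent modulo `B`. A well-formed convergent triple is a
*decomposition* of the theory `(F, E ∪ B)`. -/
structure Convergent : Prop where
  strictlyCoherent : T.StrictlyCoherent
  confluent : T.Confluent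
  operationallyTerminating : T.OperationallyTerminating

/-! ### The canonical term algebra and constructor decompositions -/

/-- The `B`-equivalence class `[t]_B`. -/
def cls {s : Sg.Srt} (t : Term Sg s) : Set (Term Sg s) := {t' | T.EqB t t'}

/-- The carrier of sort `s` of the canonical term algebra `C_{F/E,B}`: the `B`-equivalence classes
of `E,B`-irreducible ground terms of `T_F`. -/
def Canon (s : Sg.Srt) : Set (Set (Term Sg s)) :=
  {c | ∃ t : Term Sg s, t.IsGround ∧ t.Over T.sig ∧ T.Irred t ∧ c = T.cls t}

/-- The decomposition `T` protects `T₀`: there is a theory inclusion, and `T₀` and `T` agree on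
terms of `T₀` about equality modulo axioms and about canonical forms, and (`carrier`,
`operations`) the canonical term algebra of `T₀` is the reduct of that of `T`, where an
operation `f` of a canonical term algebra sends `[t₁], …, [tₙ]` to `[f(t₁, …, tₙ)!]`. -/
structure Protects (T₀ : EqTheory Sg) : Prop where
  sig_le : ∀ (w : List Sg.Srt) (s : Sg.Srt) (f : Sg.Op w s), T₀.sig f → T.sig f
  E_subset : ∀ s, T₀.E s ⊆ T.E s
  B_subset : ∀ s, T₀.B s ⊆ T.B s
  eqB_iff : ∀ (s : Sg.Srt) (t t' : Term Sg s), t.Over T₀.sig → t'.Over T₀.sig →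
    (T₀.EqB t t' ↔ T.EqB t t')
  irred_iff : ∀ (s : Sg.Srt) (t : Term Sg s), t.Over T₀.sig → (T₀.Irred t ↔ T.Irred t)
  carrier : ∀ s, T₀.Canon s = T.Canon s
  operations : ∀ (w : List Sg.Srt) (s : Sg.Srt) (f : Sg.Op w s)
    (args : ∀ i : Fin w.length, Term Sg (w.get i)), T₀.sig f →
    (∀ i, (args i).IsGround ∧ (args i).Over T₀.sig ∧ T₀.Irred (args i)) →
    ∀ n₀ n, T₀.IsNF (.app f args) n₀ → T.IsNF (.app f args) n → T₀.cls n₀ = T.cls n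

/-- Sufficient completeness with respect to the constructor subsignature `Om`. -/
structure SufficientlyComplete (Om : SubSig Sg) : Prop where
  nf_mem : ∀ (s : Sg.Srt) (t n : Term Sg s), t.IsGround → t.Over T.sig → T.IsNF t n →
    n.IsGround ∧ n.Over Om
  closed : ∀ (s : Sg.Srt) (a b : Term Sg s), a.IsGround → a.Over Om → T.EqB a b →
    b.IsGround ∧ b.Over Om

/-- `Om = (Ω, B_Ω, E_Ω)` is a constructor decomposition of `T = (Σ, B, E)`. -/
structure ConstructorDecomposition (Om : EqTheory Sg) : Prop where
  wellFormed : Om.WellFormed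
  convergent : Om.Convergent
  protects : T.Protects Om
  sufficientlyComplete : T.SufficientlyComplete Om.sig

/-! ### Satisfaction in the initial algebra, unification -/

/-- `T_{Σ/E∪B}, σ ⊨ φ` for a ground substitution `σ`: a ground equation holds in the initial
algebra iff it is provable. -/
def Sat (σ : Subst Sg) : QF Sg → Prop
  | .top => True
  | .eq a b => T.EqEB (a.subst σ) (b.subst σ)
  | .neg φ => ¬ Sat σ φ
  | .and φ ψ => Sat σ φ ∧ Sat σ ψ
  | .or φ ψ => Sat σ φ ∨ Sat σ ψ

/-- `φ` is satisfiable in the initial algebra `T_{Σ/E∪B}`. -/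
def Satisfiable (φ : QF Sg) : Prop := ∃ σ : Subst Sg, σ.IsGround ∧ σ.Over T.sig ∧ T.Sat σ φ

/-- `T_{Σ/E∪B} ⊨ φ ⇒ ψ`. -/
def Entails (φ ψ : QF Sg) : Prop :=
  ∀ σ : Subst Sg, σ.IsGround → σ.Over T.sig → T.Sat σ φ → T.Sat σ ψ

/-- `σ` is an `E ∪ B`-unifier of a system of equations. -/
def IsUnifier (sys : List (Σ s : Sg.Srt, Eqn Sg s)) (σ : Subst Sg) : Prop :=
  σ.Over T.sig ∧ ∀ e ∈ sys, T.EqEB (e.2.lhs.subst σ) (e.2.rhs.subst σ)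

/-- `U` is a complete set of `E ∪ B`-unifiers of a system of equations, the variables in `W` being
the ones of interest (from which the new variables of the unifiers are kept apart): every unifier
is on `W`, up to `E ∪ B`-equality, an instance of a unifier in `U`. -/
def IsCompleteUnifiers (W : Set (Var Sg)) (sys : List (Σ s : Sg.Srt, Eqn Sg s))
    (U : Set (Subst Sg)) : Prop :=
  (∀ α ∈ U, T.IsUnifier sys α) ∧
  ∀ σ, T.IsUnifier sys σ → ∃ α ∈ U, ∃ ρ : Subst Sg, ρ.Over T.sig ∧
    ∀ s n, (s, n) ∈ W → T.EqEB (σ s n) ((α s n).subst ρ)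

/-- Every unification problem over the signature of the theory has a finite complete set of
unifiers. -/
def FinitaryUnification : Prop :=
  ∀ sys : List (Σ s : Sg.Srt, Eqn Sg s),
    (∀ e ∈ sys, e.2.lhs.Over T.sig ∧ e.2.rhs.Over T.sig) →
    ∀ W : Set (Var Sg), W.Finite →
    ∃ U : Set (Subst Sg), U.Finite ∧ T.IsCompleteUnifiers W sys U

end EqTheory

/-! ### Rewrite theories and their canonical reachability model -/

/-- The data of a rewrite theory `(Σ, E ∪ B, R)` over the signature `Σ = Sg`. -/
structure RewriteTheory (Sg : Signature.{u, v}) where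
  E : ∀ s : Sg.Srt, Set (CondEqn Sg s)
  B : ∀ s : Sg.Srt, Set (Eqn Sg s)
  rules : ∀ s : Sg.Srt, Set (RwRule Sg s)

namespace RewriteTheory

variable (R : RewriteTheory Sg)

/-- The triple `(Σ, B, E)`. -/
def eqTheory : EqTheory Sg := ⟨SubSig.full Sg, R.E, R.B⟩

/-- The relation `t →_{R,B} t'`: for some position `p`, some rule `l → r if φ` of `R` and some
ground substitution `σ`, `t|_p =_B lσ`, `t' = t[rσ]_p`, and `φσ` holds in the initial algebra. -/
inductive RStep : ∀ {s : Sg.Srt}, Term Sg s → Term Sg s → Prop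
  | root {s : Sg.Srt} (t : Term Sg s) (r : RwRule Sg s) (σ : Subst Sg) : r ∈ R.rules s →
      σ.IsGround → R.eqTheory.EqB t (r.lhs.subst σ) → R.eqTheory.Sat σ r.cond →
      RStep t (r.rhs.subst σ)
  | arg {w : List Sg.Srt} {s : Sg.Srt} (f : Sg.Op w s)
      (args : ∀ i : Fin w.length, Term Sg (w.get i)) (i : Fin w.length)
      (t' : Term Sg (w.get i)) : RStep (args i) t' →
      RStep (.app f args) (.app f (Function.update args i t'))

/-- The rules are ground coherent with the oriented equations `E` modulo `B`. -/
def GroundCoherent : Prop :=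
  ∀ (s : Sg.Srt) (t t' a : Term Sg s), t.IsGround → R.RStep t t' → R.eqTheory.IsNF t a →
    ∃ a', R.RStep a a' ∧ ∃ n n', R.eqTheory.IsNF t' n ∧ R.eqTheory.IsNF a' n' ∧
      R.eqTheory.EqB n n'

/-- The standing requirements on a rewrite theory. -/
structure IsRewriteTheory : Prop where
  nonempty_sorts : ∀ s : Sg.Srt, ∃ t : Term Sg s, t.IsGround
  regular : ∀ s, ∀ e ∈ R.B s, e.Regular
  linear : ∀ s, ∀ e ∈ R.B s, e.Linear
  convergent : R.eqTheory.Convergent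
  groundCoherent : R.GroundCoherent

/-- The topmost requirements, for the constructor decomposition `Om = (Ω, B_Ω, E_Ω)` and the sort
`St` of states. -/
structure IsTopmost (Om : EqTheory Sg) (St : Sg.Srt) : Prop where
  constructorDecomposition : R.eqTheory.ConstructorDecomposition Om
  vars_nf : ∀ t n : Term Sg St, t.Over Om.sig → R.eqTheory.IsNF t n → t.vars = n.vars
  regular : ∀ s, ∀ e ∈ Om.B s, e.Regular
  linear : ∀ s, ∀ e ∈ Om.B s, e.Linear
  finitaryUnification : Om.FinitaryUnification
  rules_state : ∀ s, s ≠ St → R.rules s = ∅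
  lhs_over : ∀ r ∈ R.rules St, r.lhs.Over Om.sig
  topmost : ∀ (w : List Sg.Srt) (f : Sg.Op w St)
    (args : ∀ i : Fin w.length, Term Sg (w.get i)), (Term.app f args).Over Om.sig →
    ∀ (i : Fin w.length) (a : Term Sg St), Subterm a (args i) → ¬ a.Over Om.sig

/-- The one-step transition relation `[a] →_R [b]` of the canonical reachability model. -/
def Trans {s : Sg.Srt} (c d : Set (Term Sg s)) : Prop :=
  ∃ a a' b : Term Sg s, a.IsGround ∧ R.eqTheory.Irred a ∧ c = R.eqTheory.cls a ∧
    R.RStep a a' ∧ R.eqTheory.IsNF a' b ∧ d = R.eqTheory.cls b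

/-- The terminating states of the canonical reachability model. -/
def Terminating (St : Sg.Srt) : Set (Set (Term Sg St)) :=
  {c | c ∈ R.eqTheory.Canon St ∧ ¬ ∃ d, R.Trans c d}

end RewriteTheory

/-! ### Constrained constructor patterns and reachability formulas -/

/-- A constrained pattern `term | cond` of the sort `St` of states. -/
structure Pattern (Sg : Signature.{u, v}) (St : Sg.Srt) where
  term : Term Sg St
  cond : QF Sg

def Pattern.vars {St : Sg.Srt} (p : Pattern Sg St) : Set (Var Sg) := p.term.vars ∪ p.cond.vars

def Pattern.subst {St : Sg.Srt} (p : Pattern Sg St) (σ : Subst Sg) : Pattern Sg St :=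
  ⟨p.term.subst σ, p.cond.subst σ⟩

/-- The variables of a finite disjunction of patterns. -/
def patVars {St : Sg.Srt} (ps : List (Pattern Sg St)) : Set (Var Sg) := {x | ∃ p ∈ ps, x ∈ p.vars}

/-- A reachability formula `u | φ →⊛ ⋁ᵢ vᵢ | ψᵢ`. -/
structure RFormula (Sg : Signature.{u, v}) (St : Sg.Srt) where
  pre : Pattern Sg St
  post : List (Pattern Sg St)

namespace RFormula

variable {St : Sg.Srt} (F : RFormula Sg St)

def vars : Set (Var Sg) := F.pre.vars ∪ patVars F.post

/-- The parameters of the formula: the variables shared by its two sides. -/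
def params : Set (Var Sg) := F.pre.vars ∩ patVars F.post

def subst (σ : Subst Sg) : RFormula Sg St := ⟨F.pre.subst σ, F.post.map fun p => p.subst σ⟩

/-- The formula is a reachability formula over the constructors `Om`: its patterns are constructor
terms, and every variable of a `ψᵢ` occurs in `vᵢ` or in the precondition. -/
def WellFormed (Om : SubSig Sg) : Prop :=
  F.pre.term.Over Om ∧ (∀ p ∈ F.post, p.term.Over Om) ∧
    ∀ p ∈ F.post, p.cond.vars ⊆ p.term.vars ∪ F.pre.vars

end RFormula

section Semantics

variable (R : RewriteTheory Sg) (Om : EqTheory Sg) {St : Sg.Srt}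

/-- The semantics `⟦u | φ⟧` of a pattern: the canonical states `[(uρ)!]` for `ρ` a ground
constructor substitution such that `φρ` holds in the initial algebra. -/
def sem (p : Pattern Sg St) : Set (Set (Term Sg St)) :=
  {c | c ∈ R.eqTheory.Canon St ∧ ∃ (ρ : Subst Sg) (n : Term Sg St), ρ.IsGround ∧ ρ.Over Om.sig ∧
    R.eqTheory.Sat ρ p.cond ∧ R.eqTheory.IsNF (p.term.subst ρ) n ∧ c = R.eqTheory.cls n}

/-- The semantics of a finite disjunction of patterns. -/
def semOr (ps : List (Pattern Sg St)) : Set (Set (Term Sg St)) := {c | ∃ p ∈ ps, c ∈ sem R Om p}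

/-- `ρ` instantiates exactly the variables in `Y`, by ground constructor terms. -/
def IsInstantiation (Y : Set (Var Sg)) (ρ : Subst Sg) : Prop :=
  (∀ s n, (s, n) ∈ Y → (ρ s n).IsGround ∧ (ρ s n).Over Om.sig) ∧ ρ.IdOff Y

/-- All-paths satisfaction `R ⊨_T^∀ F`: for every instantiation of the parameters, every
transition sequence from a state of the precondition to a state of `⟦T⟧` goes through a state of
the postcondition. -/
def Models (T : List (Pattern Sg St)) (F : RFormula Sg St) : Prop :=
  ∀ ρ : Subst Sg, IsInstantiation Om F.params ρ →
    ∀ (n : ℕ) (c : ℕ → Set (Term Sg St)), (∀ i < n, R.Trans (c i) (c (i + 1))) →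
      c 0 ∈ sem R Om (F.pre.subst ρ) → c n ∈ semOr R Om T →
      ∃ k ≤ n, c k ∈ semOr R Om (F.post.map fun p => p.subst ρ)

/-! ### The inference system -/

/-- `β` is a parameter-preserving `E_Ω ∪ B_Ω`-match of the precondition of `F` against the
disjunct `p = vᵢ | ψᵢ` of its postcondition: `u =_{E_Ω ∪ B_Ω} vᵢβ`, where `β` instantiates only
variables of `vᵢ` that do not occur in the precondition. -/
def IsMatch (F : RFormula Sg St) (p : Pattern Sg St) (β : Subst Sg) : Prop :=
  p ∈ F.post ∧ β.Over Om.sig ∧ β.IdOff (p.term.vars \ F.pre.vars) ∧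
    Om.EqEB F.pre.term (p.term.subst β)

/-- `φ' = φ ∧ ⋀_{(i,β)} ¬ ψᵢβ`, for a finite list of matches. -/
def strengthen (φ : QF Sg) (M : List (Pattern Sg St × Subst Sg)) : QF Sg :=
  M.foldr (fun m χ => .and χ (.neg (m.1.cond.subst m.2))) φ

/-- `[A, C] ⊢_T F`, for the inference system with the two rules `Step∀ + Subsumption` and `Axiom`.

In `step`, `M` is any finite set of matches, `φ'` is `φ ∧ ⋀ ¬ ψᵢβ`, the rules `r` and the disjuncts
of `T` are renamed apart from the goal (by `ren r` and `π`), and `U r` is a complete set of unifiers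
of the left-hand sides of the goal and of the renamed `r`. The last three hypotheses are: no state
satisfying `u | φ'` is in `⟦T⟧` (by unification), parameters are preserved, and the premises are
derivable, for the unifiers whose associated constraint is satisfiable.

In `axiomRule`, the axiom `F'` is renamed apart from the goal by `π`, and `α` instantiates only
variables of its precondition, by terms without variables of the renamed axiom. -/
inductive Derives (T : List (Pattern Sg St)) :
    Set (RFormula Sg St) → Set (RFormula Sg St) → RFormula Sg St → Prop
  | step (A C : Set (RFormula Sg St)) (F : RFormula Sg St)
      (M : List (Pattern Sg St × Subst Sg)) (φ' : QF Sg)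
      (ren : RwRule Sg St → Renaming Sg) (U : RwRule Sg St → Set (Subst Sg)) :
      (∀ m ∈ M, IsMatch Om F m.1 m.2) →
      φ' = strengthen F.pre.cond M →
      (∀ r ∈ R.rules St,
        Disjoint (r.subst (ren r).toSubst).vars (RFormula.vars ⟨⟨F.pre.term, φ'⟩, F.post⟩)) →
      (∀ r ∈ R.rules St, Om.IsCompleteUnifiers
        (RFormula.vars ⟨⟨F.pre.term, φ'⟩, F.post⟩ ∪ (r.subst (ren r).toSubst).vars)
        [⟨St, F.pre.term, (r.subst (ren r).toSubst).lhs⟩] (U r)) →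
      (∀ t ∈ T, ∃ (π : Renaming Sg) (V : Set (Subst Sg)),
        Disjoint (t.subst π.toSubst).vars (RFormula.vars ⟨⟨F.pre.term, φ'⟩, F.post⟩) ∧
        Om.IsCompleteUnifiers
          (RFormula.vars ⟨⟨F.pre.term, φ'⟩, F.post⟩ ∪ (t.subst π.toSubst).vars)
          [⟨St, F.pre.term, (t.subst π.toSubst).term⟩] V ∧
        ∀ γ ∈ V, ¬ R.eqTheory.Satisfiable
          ((QF.and φ' (t.subst π.toSubst).cond).subst γ)) →
      (∀ r ∈ R.rules St, ∀ α ∈ U r,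
        R.eqTheory.Satisfiable ((QF.and φ' (r.subst (ren r).toSubst).cond).subst α) →
        (F.pre.subst α).vars ∩ patVars (F.post.map fun p => p.subst α) =
          (Pattern.subst ⟨(r.subst (ren r).toSubst).rhs,
            .and φ' (r.subst (ren r).toSubst).cond⟩ α).vars ∩
            patVars (F.post.map fun p => p.subst α)) →
      (∀ r ∈ R.rules St, ∀ α ∈ U r,
        R.eqTheory.Satisfiable ((QF.and φ' (r.subst (ren r).toSubst).cond).subst α) →
        Derives T (A ∪ C) ∅
          ⟨Pattern.subst ⟨(r.subst (ren r).toSubst).rhs,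
            .and φ' (r.subst (ren r).toSubst).cond⟩ α, F.post.map fun p => p.subst α⟩) →
      Derives T A C F
  | axiomRule (A : Set (RFormula Sg St)) (F F' : RFormula Sg St) (π : Renaming Sg)
      (α : Subst Sg) :
      F' ∈ A →
      Disjoint (F'.subst π.toSubst).vars F.vars →
      α.Over Om.sig →
      α.IdOff (F'.subst π.toSubst).pre.vars →
      (∀ s n, (s, n) ∈ (F'.subst π.toSubst).pre.vars →
        Disjoint (α s n).vars (F'.subst π.toSubst).vars) →
      Om.EqEB F.pre.term ((F'.subst π.toSubst).pre.term.subst α) →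
      R.eqTheory.Entails F.pre.cond ((F'.subst π.toSubst).pre.cond.subst α) →
      (∀ q ∈ (F'.subst π.toSubst).post,
        F.pre.vars ∩ patVars F.post =
          Pattern.vars ⟨q.term.subst α, .and F.pre.cond (q.cond.subst α)⟩ ∩ patVars F.post) →
      (∀ q ∈ (F'.subst π.toSubst).post,
        Derives T A ∅ ⟨⟨q.term.subst α, .and F.pre.cond (q.cond.subst α)⟩, F.post⟩) →
      Derives T A ∅ F

end Semantics

end CRL

open CRL

-- The proof is a strong induction on the length `n` of the transition sequence and, inside it, an
-- induction on the derivation. A circularity becomes usable only after a Step has consumed a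
-- transition; what remains of the path is then strictly shorter, so the circularities, now axioms,
-- hold along it by the outer induction. An application of Axiom may consume no transition at all,
-- but it passes to a smaller derivation. Hence the invariant of `Derives.holdsAt`: axioms hold for
-- lengths `≤ n`, circularities for lengths `< n`.
--
-- The induction needs the form `HoldsAt` of satisfaction, where one ground constructor substitution
-- `σ` instantiates the whole precondition and the state reached is an instance that agrees with `σ`
-- on the parameters. `models_of_holdsAt` returns to `Models`.
--
-- Step: if the condition of a matched disjunct holds under `σ`, the first state already satisfies
-- the postcondition. Otherwise `φ'` holds. The path cannot have length zero, since a common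
-- instance with a disjunct of `T` would factor through a unifier with satisfiable constraint. So
-- there is a first transition; it applies a rule at the root (`exists_rule_instance`). Gluing `σ`
-- with the substitution of the rule gives a unifier of `u` and `l`, which factors through some `α`
-- of the complete set (`exists_ground_instance`), and the rest of the path starts in the
-- precondition of the premise for `α`. The disjunct it meets is carried back by
-- `mem_post_of_subst`.
--
-- Axiom: the axiom leads along the path to an instance of one of its disjuncts; gluing that
-- instance with `σ` yields an instance of the precondition of the corresponding premise, which
-- handles the rest of the path.
--
-- Two facts mediate between the full signature and the constructors. By the Church-Rosser property,
-- constructor terms equal in the full theory are equal in the constructor theory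
-- (`ConstructorDecomposition.eqEB_iff`). By sufficient completeness, every ground substitution is
-- pointwise equal to a constructor one (`exists_constructor_subst`).

namespace CRL

variable {Sg : Signature.{u, v}}

/-! ### Variables and substitutions -/

/-- The substitution that applies first `σ` and then `τ`. -/
def Subst.comp (σ τ : Subst Sg) : Subst Sg := fun s n => (σ s n).subst τ

theorem Term.mem_vars_var {s s' : Sg.Srt} {n n' : ℕ} :
    (s', n') ∈ (Term.var s n : Term Sg s).vars ↔ (s', n') = (s, n) := by
  simp [Term.vars, Term.varList]

theorem Term.mem_vars_app {w : List Sg.Srt} {s : Sg.Srt} {f : Sg.Op w s}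
    {args : ∀ i : Fin w.length, Term Sg (w.get i)} {x : Var Sg} :
    x ∈ (Term.app f args).vars ↔ ∃ i, x ∈ (args i).vars := by
  simp only [Term.vars, Term.varList, Set.mem_ofPred_eq, List.mem_flatten, List.mem_ofFn]
  constructor
  · rintro ⟨l, ⟨i, rfl⟩, h⟩
    exact ⟨i, h⟩
  · rintro ⟨i, h⟩
    exact ⟨_, ⟨i, rfl⟩, h⟩

theorem Term.subst_comp (σ τ : Subst Sg) {s : Sg.Srt} (t : Term Sg s) :
    (t.subst σ).subst τ = t.subst (σ.comp τ) := by
  induction t with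
  | var s n => rfl
  | app f args ih => simp only [Term.subst, ih]

theorem Term.subst_congr {σ τ : Subst Sg} {s : Sg.Srt} {t : Term Sg s}
    (h : ∀ s n, (s, n) ∈ t.vars → σ s n = τ s n) : t.subst σ = t.subst τ := by
  induction t with
  | var s n => exact h s n (Term.mem_vars_var.2 rfl)
  | app f args ih =>
    simp only [Term.subst]
    congr 1
    funext i
    exact ih i fun s n hx => h s n (Term.mem_vars_app.2 ⟨i, hx⟩)

theorem Term.subst_var {s : Sg.Srt} (t : Term Sg s) : t.subst Term.var = t := by
  induction t with
  | var s n => rfl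
  | app f args ih => simp only [Term.subst, ih]

theorem Term.IsGround.subst_eq {s : Sg.Srt} {t : Term Sg s} (h : t.IsGround) (σ : Subst Sg) :
    t.subst σ = t := by
  have h' : t.vars = ∅ := h
  rw [Term.subst_congr (τ := Term.var) (by simp [h']), Term.subst_var]

theorem Term.mem_vars_subst {σ : Subst Sg} {s : Sg.Srt} {t : Term Sg s} {x : Var Sg} :
    x ∈ (t.subst σ).vars ↔ ∃ s' n, (s', n) ∈ t.vars ∧ x ∈ (σ s' n).vars := by
  induction t with
  | var s n =>
    constructor
    · exact fun h => ⟨s, n, Term.mem_vars_var.2 rfl, h⟩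
    · rintro ⟨s', n', h, hx⟩
      cases Term.mem_vars_var.1 h
      exact hx
  | app f args ih =>
    simp only [Term.subst, Term.mem_vars_app, ih]
    constructor
    · rintro ⟨i, s', n', h, hx⟩
      exact ⟨s', n', ⟨i, h⟩, hx⟩
    · rintro ⟨s', n', ⟨i, h⟩, hx⟩
      exact ⟨i, s', n', h, hx⟩

theorem Term.isGround_subst {σ : Subst Sg} (hσ : σ.IsGround) {s : Sg.Srt} (t : Term Sg s) :
    (t.subst σ).IsGround := by
  refine Set.eq_empty_iff_forall_notMem.2 fun x hx => ?_
  obtain ⟨s', n, -, h⟩ := Term.mem_vars_subst.1 hx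
  exact (Set.eq_empty_iff_forall_notMem.1 (hσ s' n)) x h

theorem Term.Over.subst {F : SubSig Sg} {σ : Subst Sg} (hσ : σ.Over F) {s : Sg.Srt}
    {t : Term Sg s} (ht : t.Over F) : (t.subst σ).Over F := by
  induction t with
  | var s n => exact hσ s n
  | app f args ih => exact ⟨ht.1, fun i => ih i (ht.2 i)⟩

theorem Term.Over.mono {F G : SubSig Sg} (hFG : ∀ w s (f : Sg.Op w s), F f → G f) {s : Sg.Srt}
    {t : Term Sg s} (ht : t.Over F) : t.Over G := by
  induction t with
  | var s n => trivial
  | app f args ih => exact ⟨hFG _ _ f ht.1, fun i => ih i (ht.2 i)⟩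

theorem Term.over_full {s : Sg.Srt} (t : Term Sg s) : t.Over (SubSig.full Sg) := by
  induction t with
  | var s n => trivial
  | app f args ih => exact ⟨trivial, ih⟩

theorem Subterm.isOver {F : SubSig Sg} {s s' : Sg.Srt} {a : Term Sg s'} {t : Term Sg s}
    (h : Subterm a t) (ht : t.Over F) : a.Over F := by
  induction h with
  | refl => exact ht
  | arg f args i _ ih => exact ih (ht.2 i)

theorem Subst.Over.comp {F : SubSig Sg} {σ τ : Subst Sg} (hσ : σ.Over F) (hτ : τ.Over F) :
    (σ.comp τ).Over F := fun s n => (hσ s n).subst hτ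

theorem Subst.IsGround.comp {τ : Subst Sg} (hτ : τ.IsGround) (σ : Subst Sg) :
    (σ.comp τ).IsGround := fun s n => (σ s n).isGround_subst hτ

theorem CondEqn.Over.mono {F G : SubSig Sg} (hFG : ∀ w s (f : Sg.Op w s), F f → G f) {s : Sg.Srt}
    {e : CondEqn Sg s} (he : e.Over F) : e.Over G :=
  ⟨he.1.mono hFG, he.2.1.mono hFG, fun c hc => ⟨(he.2.2 c hc).1.mono hFG, (he.2.2 c hc).2.mono hFG⟩⟩

theorem QF.mem_vars_subst {σ : Subst Sg} {φ : QF Sg} {x : Var Sg} :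
    x ∈ (φ.subst σ).vars ↔ ∃ s' n, (s', n) ∈ φ.vars ∧ x ∈ (σ s' n).vars := by
  induction φ with
  | top => simp [QF.subst, QF.vars]
  | eq a b =>
    simp only [QF.subst, QF.vars, Set.mem_union, Term.mem_vars_subst]
    grind
  | neg φ ih => exact ih
  | and φ ψ h1 h2 =>
    simp only [QF.subst, QF.vars, Set.mem_union, h1, h2]
    grind
  | or φ ψ h1 h2 =>
    simp only [QF.subst, QF.vars, Set.mem_union, h1, h2]
    grind

theorem Pattern.mem_vars_subst {St : Sg.Srt} {σ : Subst Sg} {p : Pattern Sg St} {x : Var Sg} :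
    x ∈ (p.subst σ).vars ↔ ∃ s' n, (s', n) ∈ p.vars ∧ x ∈ (σ s' n).vars := by
  simp only [Pattern.subst, Pattern.vars, Set.mem_union, Term.mem_vars_subst, QF.mem_vars_subst]
  grind

theorem mem_patVars_map_subst {St : Sg.Srt} {σ : Subst Sg} {ps : List (Pattern Sg St)} {x : Var Sg} :
    x ∈ patVars (ps.map fun p => p.subst σ) ↔
      ∃ s' n, (s', n) ∈ patVars ps ∧ x ∈ (σ s' n).vars := by
  constructor
  · rintro ⟨p, hp, hx⟩
    obtain ⟨q, hq, rfl⟩ := List.mem_map.1 hp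
    obtain ⟨s', n, h, hx⟩ := Pattern.mem_vars_subst.1 hx
    exact ⟨s', n, ⟨q, hq, h⟩, hx⟩
  · rintro ⟨s', n, ⟨q, hq, h⟩, hx⟩
    exact ⟨q.subst σ, List.mem_map.2 ⟨q, hq, rfl⟩, Pattern.mem_vars_subst.2 ⟨s', n, h, hx⟩⟩

/-! ### Renaming and gluing of substitutions -/

/-- The substitution `σ`, transported to renamed variables. -/
def Renaming.conj (π : Renaming Sg) (σ : Subst Sg) : Subst Sg := fun s n => σ s ((π s).symm n)

theorem Renaming.toSubst_comp (π : Renaming Sg) (σ : Subst Sg) :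
    π.toSubst.comp σ = fun s n => σ s (π s n) := rfl

theorem Renaming.toSubst_over (π : Renaming Sg) (F : SubSig Sg) : π.toSubst.Over F :=
  fun _ _ => trivial

theorem Renaming.mem_vars_subst_pattern {St : Sg.Srt} {π : Renaming Sg} {p : Pattern Sg St}
    {s : Sg.Srt} {n : ℕ} (h : (s, n) ∈ p.vars) : (s, π s n) ∈ (p.subst π.toSubst).vars :=
  Pattern.mem_vars_subst.2 ⟨s, n, h, Term.mem_vars_var.2 rfl⟩

open Classical in
/-- The substitution that is `σ` on `D` and `τ` elsewhere. -/
noncomputable def Subst.piecewise (D : Set (Var Sg)) (σ τ : Subst Sg) : Subst Sg :=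
  fun s n => if (s, n) ∈ D then σ s n else τ s n

theorem Subst.piecewise_mem {D : Set (Var Sg)} {σ τ : Subst Sg} {s : Sg.Srt} {n : ℕ}
    (h : (s, n) ∈ D) : Subst.piecewise D σ τ s n = σ s n := if_pos h

theorem Subst.piecewise_notMem {D : Set (Var Sg)} {σ τ : Subst Sg} {s : Sg.Srt} {n : ℕ}
    (h : (s, n) ∉ D) : Subst.piecewise D σ τ s n = τ s n := if_neg h

theorem Subst.IsGround.piecewise {D : Set (Var Sg)} {σ τ : Subst Sg} (hσ : σ.IsGround)
    (hτ : τ.IsGround) : (Subst.piecewise D σ τ).IsGround := fun s n => by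
  unfold Subst.piecewise
  split_ifs
  exacts [hσ s n, hτ s n]

theorem Subst.Over.piecewise {F : SubSig Sg} {D : Set (Var Sg)} {σ τ : Subst Sg} (hσ : σ.Over F)
    (hτ : τ.Over F) : (Subst.piecewise D σ τ).Over F := fun s n => by
  unfold Subst.piecewise
  split_ifs
  exacts [hσ s n, hτ s n]

/-! ### Equational deduction -/

namespace ProvEq

variable {F G : SubSig Sg} {Ax Ax' : ∀ s : Sg.Srt, Set (CondEqn Sg s)}

theorem isOver {s : Sg.Srt} {t t' : Term Sg s} (h : ProvEq F Ax t t') : t.Over F ∧ t'.Over F := by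
  induction h with
  | refl t ht => exact ⟨ht, ht⟩
  | symm _ ih => exact ih.symm
  | trans _ _ h1 h2 => exact ⟨h1.1, h2.2⟩
  | congr f args args' hf _ ih => exact ⟨⟨hf, fun i => (ih i).1⟩, hf, fun i => (ih i).2⟩
  | ax e σ _ he hσ _ _ => exact ⟨he.1.subst hσ, he.2.1.subst hσ⟩

theorem mono (hFG : ∀ w s (f : Sg.Op w s), F f → G f) (hAx : ∀ s, Ax s ⊆ Ax' s) {s : Sg.Srt}
    {t t' : Term Sg s} (h : ProvEq F Ax t t') : ProvEq G Ax' t t' := by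
  induction h with
  | refl t ht => exact .refl t (ht.mono hFG)
  | symm _ ih => exact ih.symm
  | trans _ _ h1 h2 => exact h1.trans h2
  | congr f args args' hf _ ih => exact .congr f args args' (hFG _ _ f hf) ih
  | ax e σ hm he hσ _ ih =>
    exact .ax e σ (hAx _ hm) (he.mono hFG) (fun s n => (hσ s n).mono hFG) ih

theorem subst {δ : Subst Sg} (hδ : δ.Over F) {s : Sg.Srt} {t t' : Term Sg s}
    (h : ProvEq F Ax t t') : ProvEq F Ax (t.subst δ) (t'.subst δ) := by
  induction h with
  | refl t ht => exact .refl _ (ht.subst hδ)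
  | symm _ ih => exact ih.symm
  | trans _ _ h1 h2 => exact h1.trans h2
  | congr f args args' hf _ ih => exact .congr f _ _ hf ih
  | ax e σ hm he hσ _ ih =>
    simp only [Term.subst_comp] at ih ⊢
    exact .ax e _ hm he (hσ.comp hδ) ih

theorem subst_pointwise {σ τ : Subst Sg} {s : Sg.Srt} {t : Term Sg s} (ht : t.Over F)
    (h : ∀ s n, (s, n) ∈ t.vars → ProvEq F Ax (σ s n) (τ s n)) :
    ProvEq F Ax (t.subst σ) (t.subst τ) := by
  induction t with
  | var s n => exact h s n (Term.mem_vars_var.2 rfl)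
  | app f args ih =>
    exact .congr f _ _ ht.1 fun i =>
      ih i (ht.2 i) fun s n hx => h s n (Term.mem_vars_app.2 ⟨i, hx⟩)

end ProvEq

-- Rewriting modulo axioms, canonical forms and states

namespace EqTheory

variable {T : EqTheory Sg}

theorem EqB.eqEB {s : Sg.Srt} {t t' : Term Sg s} (h : T.EqB t t') : T.EqEB t t' :=
  ProvEq.mono (fun _ _ _ h => h) (fun _ => Set.subset_union_right) h

-- The two inductions are intertwined because a root step carries joinability proofs for its
-- conditions, and joinability is made of steps.
mutual
theorem EStep.eqEB : ∀ {s : Sg.Srt} {t t' : Term Sg s}, T.EStep t t' → T.EqEB t t'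
  | _, _, _, .root _ e σ hm he hσ hB hc =>
    (EqB.eqEB hB).trans (.ax e σ (Or.inl hm) he hσ fun c hcm => EJoin.eqEB (hc c hcm))
  | _, _, _, .arg f args i t' hf ho h => by
    have h' := EStep.eqEB h
    refine ProvEq.congr f _ _ hf fun j => ?_
    by_cases hj : j = i
    · subst hj
      rw [Function.update_self]
      exact h'
    · rw [Function.update_of_ne hj]
      exact .refl _ (ho j)
theorem EJoin.eqEB : ∀ {s : Sg.Srt} {t t' : Term Sg s}, T.EJoin t t' → T.EqEB t t'
  | _, _, _, .eqB h => EqB.eqEB h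
  | _, _, _, .left h h' => (EStep.eqEB h).trans (EJoin.eqEB h')
  | _, _, _, .right h h' => (EJoin.eqEB h').trans (EStep.eqEB h).symm
end

theorem ESteps.eqEB {s : Sg.Srt} {t t' : Term Sg s} (h : T.ESteps t t') (ht : t.Over T.sig) :
    T.EqEB t t' := by
  induction h with
  | refl => exact .refl _ ht
  | tail _ h ih => exact ih.trans h.eqEB

theorem ESteps.isOver {s : Sg.Srt} {t t' : Term Sg s} (h : T.ESteps t t') (ht : t.Over T.sig) :
    t'.Over T.sig := (h.eqEB ht).isOver.2

theorem Irred.eq_of_eSteps {s : Sg.Srt} {t t' : Term Sg s} (ht : T.Irred t) (h : T.ESteps t t') :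
    t = t' := by
  rcases Relation.ReflTransGen.cases_head h with h | ⟨a, ha, -⟩
  · exact h
  · exact absurd ha (ht a)

theorem OperationallyTerminating.exists_isNF (hT : T.OperationallyTerminating) {s : Sg.Srt}
    (t : Term Sg s) : ∃ n, T.IsNF t n := by
  have key : ∀ p : Σ s : Sg.Srt, Term Sg s, ∃ n, T.IsNF p.2 n := fun p => by
    induction p using hT.induction with
    | _ p ih =>
      by_cases hp : T.Irred p.2
      · exact ⟨p.2, .refl, hp⟩
      · obtain ⟨t', ht'⟩ := not_forall_not.1 hp
        obtain ⟨n, hn⟩ := ih ⟨p.1, t'⟩ (.step ht')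
        exact ⟨n, hn.1.head ht', hn.2⟩
  exact key ⟨s, t⟩

theorem StrictlyCoherent.eSteps (hT : T.StrictlyCoherent) {s : Sg.Srt} {t u t' : Term Sg s}
    (h : T.EqB t u) (hs : T.ESteps t t') : ∃ u', T.ESteps u u' ∧ T.EqB t' u' := by
  induction hs with
  | refl => exact ⟨u, .refl, h⟩
  | tail _ hst ih =>
    obtain ⟨u', hu, hB⟩ := ih
    obtain ⟨u'', hu', hB'⟩ := hT _ _ _ _ hB hst
    exact ⟨u'', hu.tail hu', hB'⟩

theorem ESteps.arg {w : List Sg.Srt} {s : Sg.Srt} (f : Sg.Op w s)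
    (args : ∀ i : Fin w.length, Term Sg (w.get i)) (i : Fin w.length) (hf : T.sig f)
    (ho : ∀ j, (args j).Over T.sig) {t' : Term Sg (w.get i)} (h : T.ESteps (args i) t') :
    T.ESteps (.app f args) (.app f (Function.update args i t')) := by
  induction h with
  | refl =>
    rw [Function.update_eq_self]
    exact .refl
  | @tail b c hb hst ih =>
    refine ih.tail ?_
    have := EStep.arg (T := T) f (Function.update args i b) i c hf (fun j => ?_)
      (by rwa [Function.update_self])
    · rwa [Function.update_idem] at this
    · by_cases hj : j = i
      · subst hj
        rw [Function.update_self]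
        exact ESteps.isOver hb (ho j)
      · rw [Function.update_of_ne hj]
        exact ho j

/-- The arguments are normalized one at a time, by induction on the set of positions already
treated. -/
theorem ESteps.app {w : List Sg.Srt} {s : Sg.Srt} (f : Sg.Op w s)
    (args args' : ∀ i : Fin w.length, Term Sg (w.get i)) (hf : T.sig f)
    (ho : ∀ j, (args j).Over T.sig) (h : ∀ i, T.ESteps (args i) (args' i)) :
    T.ESteps (.app f args) (.app f args') := by
  have key : ∀ S : Finset (Fin w.length),
      T.ESteps (.app f args) (.app f (S.piecewise args' args)) := fun S => by
    induction S using Finset.induction with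
    | empty =>
      rw [Finset.piecewise_empty]
      exact .refl
    | insert i S hi ih =>
      rw [Finset.piecewise_insert]
      refine ih.trans (ESteps.arg f _ i hf (fun j => ?_) ?_)
      · by_cases hj : j ∈ S
        · rw [Finset.piecewise_eq_of_mem _ _ _ hj]
          exact (h j).isOver (ho j)
        · rw [Finset.piecewise_eq_of_notMem _ _ _ hj]
          exact ho j
      · rw [Finset.piecewise_eq_of_notMem _ _ _ hi]
        exact h i
  have := key Finset.univ
  rwa [Finset.piecewise_univ] at this

theorem EJoin.of_eSteps {s : Sg.Srt} {t t' a b : Term Sg s} (h : T.ESteps t a)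
    (h' : T.ESteps t' b) (hB : T.EqB a b) : T.EJoin t t' := by
  induction h using Relation.ReflTransGen.head_induction_on with
  | refl =>
    induction h' using Relation.ReflTransGen.head_induction_on with
    | refl => exact .eqB hB
    | head hst _ ih => exact .right hst ih
  | head hst _ ih => exact .left hst ih

/-- The Church-Rosser property modulo `B`. -/
theorem Convergent.churchRosser (hT : T.Convergent) {s : Sg.Srt} {t t' : Term Sg s}
    (h : T.EqEB t t') : ∃ a b, T.ESteps t a ∧ T.ESteps t' b ∧ T.EqB a b := by
  unfold EqTheory.EqEB at h
  induction h with
  | refl t ht => exact ⟨t, t, .refl, .refl, .refl t ht⟩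
  | symm _ ih =>
    obtain ⟨a, b, ha, hb, hab⟩ := ih
    exact ⟨b, a, hb, ha, hab.symm⟩
  -- Confluence closes the two valleys at the middle term; strict coherence then transports the
  -- added steps across the `B`-equalities to the outer terms.
  | trans h _ h1 h2 =>
    obtain ⟨a, b, ha, hb, hab⟩ := h1
    obtain ⟨c, d, hc, hd, hcd⟩ := h2
    obtain ⟨b', c', hb', hc', hbc⟩ := hT.confluent _ _ _ _ h.isOver.2 hb hc
    obtain ⟨a', ha', hBa⟩ := hT.strictlyCoherent.eSteps (ProvEq.symm hab) hb'
    obtain ⟨d', hd', hBd⟩ := hT.strictlyCoherent.eSteps hcd hc'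
    exact ⟨a', d', ha.trans ha', hd.trans hd', (ProvEq.symm hBa).trans (hbc.trans hBd)⟩
  | congr f args args' hf h ih =>
    choose a b ha hb hab using ih
    exact ⟨_, _, ESteps.app f args a hf (fun j => (h j).isOver.1) ha,
      ESteps.app f args' b hf (fun j => (h j).isOver.2) hb, .congr f a b hf hab⟩
  | ax e σ hm he hσ _ ih =>
    -- An equation of `E` becomes a rewrite step, its conditions being joinable by induction; an
    -- axiom of `B` is already a `B`-equality.
    rcases hm with hm | hm
    · refine ⟨_, _, .single (.root _ e σ hm he hσ (.refl _ (he.1.subst hσ)) fun c hc => ?_), .refl,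
        .refl _ (he.2.1.subst hσ)⟩
      obtain ⟨a, b, ha, hb, hab⟩ := ih c hc
      exact .of_eSteps ha hb hab
    · refine ⟨_, _, .refl, .refl, .ax e σ hm he hσ ?_⟩
      obtain ⟨b, -, rfl⟩ := hm
      simp

/-- Irreducible terms have only trivial rewrite sequences, so the Church-Rosser valley reduces to
its bottom. -/
theorem Convergent.eqB_of_irred (hT : T.Convergent) {s : Sg.Srt} {t t' : Term Sg s}
    (h : T.EqEB t t') (ht : T.Irred t) (ht' : T.Irred t') : T.EqB t t' := by
  obtain ⟨a, b, ha, hb, hab⟩ := hT.churchRosser h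
  rwa [ht.eq_of_eSteps ha, ht'.eq_of_eSteps hb]

theorem cls_eq_of_eqB {s : Sg.Srt} {t t' : Term Sg s} (h : T.EqB t t') : T.cls t = T.cls t' :=
  Set.ext fun _ => ⟨fun h' => h.symm.trans h', fun h' => h.trans h'⟩

theorem eqB_of_cls_eq {s : Sg.Srt} {t t' : Term Sg s} (h : T.cls t = T.cls t')
    (ht' : t'.Over T.sig) : T.EqB t t' := by
  have : t' ∈ T.cls t := h ▸ ProvEq.refl t' ht'
  exact this

/-- A decomposition with constructors identifies no more constructor terms than the constructor
theory. -/
theorem ConstructorDecomposition.eqEB_iff {Om : EqTheory Sg} (hT : T.Convergent)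
    (hc : T.ConstructorDecomposition Om) {s : Sg.Srt} {t t' : Term Sg s} (ht : t.Over Om.sig)
    (ht' : t'.Over Om.sig) : Om.EqEB t t' ↔ T.EqEB t t' := by
  have mono : ∀ {a b : Term Sg s}, Om.EqEB a b → T.EqEB a b := fun h =>
    ProvEq.mono hc.protects.sig_le
      (fun s => Set.union_subset_union (hc.protects.E_subset s) (by
        rintro _ ⟨b, hb, rfl⟩
        exact ⟨b, hc.protects.B_subset s hb, rfl⟩)) h
  refine ⟨mono, fun h => ?_⟩
  -- The canonical forms are computed in the constructor theory. They are irreducible in the full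
  -- theory as well, hence `B`-equal there, and protection brings this `B`-equality back.
  obtain ⟨n, hn, hni⟩ := hc.convergent.operationallyTerminating.exists_isNF t
  obtain ⟨n', hn', hni'⟩ := hc.convergent.operationallyTerminating.exists_isNF t'
  have h1 := hn.eqEB ht
  have h2 := hn'.eqEB ht'
  have h3 : T.EqEB n n' := (mono h1).symm.trans (h.trans (mono h2))
  have h4 := hT.eqB_of_irred h3 ((hc.protects.irred_iff _ _ h1.isOver.2).1 hni)
    ((hc.protects.irred_iff _ _ h2.isOver.2).1 hni')
  exact h1.trans ((EqB.eqEB ((hc.protects.eqB_iff _ _ _ h1.isOver.2 h2.isOver.2).2 h4)).trans h2.symm)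

/-- The state `c` is the class of a canonical form of `t`. -/
def HasState (T : EqTheory Sg) {s : Sg.Srt} (t : Term Sg s) (c : Set (Term Sg s)) : Prop :=
  ∃ n, T.IsNF t n ∧ c = T.cls n

/-- Canonical forms of equal terms are `B`-equal. This allows a substitution to be replaced by a
pointwise equal one without changing the state. -/
theorem HasState.of_eqEB (hT : T.Convergent) {s : Sg.Srt} {t t' : Term Sg s}
    {c : Set (Term Sg s)} (h : T.HasState t c) (he : T.EqEB t t') : T.HasState t' c := by
  obtain ⟨n, hn, rfl⟩ := h
  obtain ⟨n', hn'⟩ := hT.operationallyTerminating.exists_isNF t'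
  refine ⟨n', hn', cls_eq_of_eqB (hT.eqB_of_irred ?_ hn.2 hn'.2)⟩
  exact (hn.1.eqEB he.isOver.1).symm.trans (ProvEq.trans he (hn'.1.eqEB he.isOver.2))

theorem HasState.eqEB {s : Sg.Srt} {t t' : Term Sg s} {c : Set (Term Sg s)}
    (h : T.HasState t c) (h' : T.HasState t' c) (ht : t.Over T.sig) (ht' : t'.Over T.sig) :
    T.EqEB t t' := by
  obtain ⟨n, hn, rfl⟩ := h
  obtain ⟨n', hn', hc⟩ := h'
  exact (hn.1.eqEB ht).trans
    ((EqB.eqEB (eqB_of_cls_eq hc (hn'.1.isOver ht'))).trans (hn'.1.eqEB ht').symm)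

theorem sat_subst {σ β : Subst Sg} {φ : QF Sg} :
    T.Sat σ (φ.subst β) ↔ T.Sat (β.comp σ) φ := by
  induction φ with
  | top => rfl
  | eq a b => simp only [QF.subst, EqTheory.Sat, Term.subst_comp]
  | neg φ ih => exact not_congr ih
  | and φ ψ h1 h2 => exact and_congr h1 h2
  | or φ ψ h1 h2 => exact or_congr h1 h2

end EqTheory

-- Truth in the initial algebra, topmost rewriting and ground constructor instances

namespace RewriteTheory

variable {R : RewriteTheory Sg}

theorem eqEB_refl {s : Sg.Srt} (t : Term Sg s) : R.eqTheory.EqEB t t := .refl t t.over_full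

theorem sat_congr {σ τ : Subst Sg} {φ : QF Sg}
    (h : ∀ s n, (s, n) ∈ φ.vars → R.eqTheory.EqEB (σ s n) (τ s n)) :
    R.eqTheory.Sat σ φ ↔ R.eqTheory.Sat τ φ := by
  induction φ with
  | top => rfl
  | eq a b =>
    have ha : R.eqTheory.EqEB (a.subst σ) (a.subst τ) :=
      ProvEq.subst_pointwise a.over_full fun s n hx => h s n (Or.inl hx)
    have hb : R.eqTheory.EqEB (b.subst σ) (b.subst τ) :=
      ProvEq.subst_pointwise b.over_full fun s n hx => h s n (Or.inr hx)
    exact ⟨fun h => (ProvEq.symm ha).trans (ProvEq.trans h hb),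
      fun h => ProvEq.trans ha (ProvEq.trans h hb.symm)⟩
  | neg φ ih => exact not_congr (ih h)
  | and φ ψ h1 h2 =>
    exact and_congr (h1 fun s n hx => h s n (Or.inl hx)) (h2 fun s n hx => h s n (Or.inr hx))
  | or φ ψ h1 h2 =>
    exact or_congr (h1 fun s n hx => h s n (Or.inl hx)) (h2 fun s n hx => h s n (Or.inr hx))

/-- A rewrite step takes place at a subterm of a sort that has rules. -/
theorem RStep.exists_subterm {s : Sg.Srt} {t t' : Term Sg s} (h : R.RStep t t') :
    ∃ (s' : Sg.Srt) (a : Term Sg s'), Subterm a t ∧ (R.rules s').Nonempty := by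
  induction h with
  | root t r σ hr _ _ _ => exact ⟨_, t, .refl, r, hr⟩
  | arg f args i t' _ ih =>
    obtain ⟨s', a, ha, hr⟩ := ih
    exact ⟨s', a, .arg f args i ha, hr⟩

/-- Rewriting a constructor state of a topmost theory takes place at the root. -/
theorem IsTopmost.rStep_root {Om : EqTheory Sg} {St : Sg.Srt} (h : R.IsTopmost Om St)
    {t t' : Term Sg St} (ht : t.Over Om.sig) (hs : R.RStep t t') :
    ∃ r ∈ R.rules St, ∃ σ : Subst Sg, σ.IsGround ∧ R.eqTheory.EqB t (r.lhs.subst σ) ∧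
      R.eqTheory.Sat σ r.cond ∧ t' = r.rhs.subst σ := by
  cases hs with
  | root _ r σ hr hσ hB hc => exact ⟨r, hr, σ, hσ, hB, hc, rfl⟩
  | arg f args i t'' hst =>
    obtain ⟨s', a, ha, hr⟩ := hst.exists_subterm
    -- Only the sort of states has rules, so a step below the root would exhibit a constructor state
    -- strictly inside a constructor state.
    have hs' : s' = St := by
      by_contra hne
      rw [h.rules_state s' hne] at hr
      exact Set.not_nonempty_empty hr
    subst hs'
    exact absurd (ha.isOver (ht.2 i)) (h.topmost _ f args ht i a ha)

theorem exists_constructor_eqEB {Om : EqTheory Sg} (hR : R.IsRewriteTheory)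
    (hc : R.eqTheory.ConstructorDecomposition Om) {s : Sg.Srt} {t : Term Sg s} (ht : t.IsGround) :
    ∃ n : Term Sg s, n.IsGround ∧ n.Over Om.sig ∧ R.eqTheory.EqEB t n := by
  obtain ⟨n, hn⟩ := hR.convergent.operationallyTerminating.exists_isNF t
  obtain ⟨hg, ho⟩ := hc.sufficientlyComplete.nf_mem _ _ _ ht t.over_full hn
  exact ⟨n, hg, ho, hn.1.eqEB t.over_full⟩

/-- Rules are applied with arbitrary ground substitutions, whereas instances of patterns and
unifiers must be over the constructors; this closes the gap. -/
theorem exists_constructor_subst {Om : EqTheory Sg} (hR : R.IsRewriteTheory)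
    (hc : R.eqTheory.ConstructorDecomposition Om) {σ : Subst Sg} (hσ : σ.IsGround) :
    ∃ τ : Subst Sg, τ.IsGround ∧ τ.Over Om.sig ∧ ∀ s n, R.eqTheory.EqEB (σ s n) (τ s n) := by
  choose τ h1 h2 h3 using fun s n => exists_constructor_eqEB hR hc (hσ s n)
  exact ⟨τ, h1, h2, h3⟩

theorem exists_ground_constructor_subst {Om : EqTheory Sg} (hR : R.IsRewriteTheory)
    (hc : R.eqTheory.ConstructorDecomposition Om) :
    ∃ τ : Subst Sg, τ.IsGround ∧ τ.Over Om.sig := by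
  choose g hg using hR.nonempty_sorts
  obtain ⟨τ, h1, h2, -⟩ := exists_constructor_subst hR hc (σ := fun s _ => g s) fun s _ => hg s
  exact ⟨τ, h1, h2⟩

/-- A ground constructor unifier is on the variables of interest a ground constructor instance of
a unifier in a complete set, up to equality in `R`. -/
theorem exists_ground_instance {Om : EqTheory Sg} (hR : R.IsRewriteTheory)
    (hc : R.eqTheory.ConstructorDecomposition Om) {W : Set (Var Sg)} {St : Sg.Srt}
    {a b : Term Sg St} (ha : a.Over Om.sig) (hb : b.Over Om.sig) {U : Set (Subst Sg)}
    (hU : Om.IsCompleteUnifiers W [⟨St, a, b⟩] U) {σ : Subst Sg} (hσ : σ.IsGround)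
    (hσo : σ.Over Om.sig) (h : R.eqTheory.EqEB (a.subst σ) (b.subst σ)) :
    ∃ α ∈ U, α.Over Om.sig ∧ ∃ ρ : Subst Sg, ρ.IsGround ∧ ρ.Over Om.sig ∧
      ∀ s n, (s, n) ∈ W → R.eqTheory.EqEB (σ s n) ((α s n).subst ρ) := by
  have hun : Om.IsUnifier [⟨St, a, b⟩] σ := by
    refine ⟨hσo, fun e he => ?_⟩
    rw [List.mem_singleton.1 he]
    exact (hc.eqEB_iff hR.convergent (ha.subst hσo) (hb.subst hσo)).2 h
  obtain ⟨α, hα, ρ, hρ, hinst⟩ := hU.2 σ hun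
  -- The instantiating `ρ` need not be ground. Composing with any ground constructor `δ` makes it
  -- so, and leaves the ground values of `σ` unchanged.
  obtain ⟨δ, hδ, hδo⟩ := exists_ground_constructor_subst hR hc
  have hαo := (hU.1 α hα).1
  refine ⟨α, hα, hαo, ρ.comp δ, hδ.comp ρ, hρ.comp hδo, fun s n hx => ?_⟩
  have h1 := ProvEq.subst hδo (hinst s n hx)
  rw [(hσ s n).subst_eq, Term.subst_comp] at h1
  exact (hc.eqEB_iff hR.convergent (hσo s n) ((hαo s n).subst (hρ.comp hδo))).1 h1

end RewriteTheory

/-! ### Soundness -/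

section Soundness

variable {R : RewriteTheory Sg} {Om : EqTheory Sg} {St : Sg.Srt}

/-- The state `c` is the instance of the pattern `p` by the ground constructor substitution `σ`. -/
structure InstanceState (R : RewriteTheory Sg) (Om : EqTheory Sg) (p : Pattern Sg St) (σ : Subst Sg)
    (c : Set (Term Sg St)) : Prop where
  ground : σ.IsGround
  isOver : σ.Over Om.sig
  sat : R.eqTheory.Sat σ p.cond
  state : R.eqTheory.HasState (p.term.subst σ) c

theorem InstanceState.mem_sem (hc : R.eqTheory.ConstructorDecomposition Om) {p : Pattern Sg St}
    {σ : Subst Sg} {c : Set (Term Sg St)} (h : InstanceState R Om p σ c) : c ∈ sem R Om p := by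
  obtain ⟨n, hn, hcn⟩ := h.state
  have hg := (hc.sufficientlyComplete.nf_mem _ _ _ (p.term.isGround_subst h.ground)
    (Term.over_full _) hn).1
  exact ⟨⟨n, hg, n.over_full, hn.2, hcn⟩, σ, n, h.ground, h.isOver, h.sat, hn, hcn⟩

theorem exists_instanceState_of_mem_sem {p : Pattern Sg St} {c : Set (Term Sg St)}
    (h : c ∈ sem R Om p) : ∃ σ, InstanceState R Om p σ c := by
  obtain ⟨-, σ, n, hg, ho, hs, hn, hcn⟩ := h
  exact ⟨σ, hg, ho, hs, n, hn, hcn⟩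

theorem InstanceState.congr (hR : R.IsRewriteTheory) {p : Pattern Sg St} {σ τ : Subst Sg}
    {c : Set (Term Sg St)} (h : InstanceState R Om p σ c) (hτ : τ.IsGround) (hτo : τ.Over Om.sig)
    (hστ : ∀ s n, (s, n) ∈ p.vars → R.eqTheory.EqEB (σ s n) (τ s n)) :
    InstanceState R Om p τ c :=
  ⟨hτ, hτo, (RewriteTheory.sat_congr fun s n hx => hστ s n (Or.inr hx)).1 h.sat,
    h.state.of_eqEB hR.convergent
      (ProvEq.subst_pointwise p.term.over_full fun s n hx => hστ s n (Or.inl hx))⟩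

theorem instanceState_subst {p : Pattern Sg St} {α σ : Subst Sg} {c : Set (Term Sg St)}
    (hα : α.Over Om.sig) (h : InstanceState R Om (p.subst α) σ c) :
    InstanceState R Om p (α.comp σ) c :=
  ⟨h.ground.comp α, hα.comp h.isOver, EqTheory.sat_subst.1 h.sat, by
    rw [← Term.subst_comp]
    exact h.state⟩

theorem InstanceState.subst {p : Pattern Sg St} {α σ : Subst Sg} {c : Set (Term Sg St)}
    (h : InstanceState R Om p (α.comp σ) c) (hσ : σ.IsGround) (hσo : σ.Over Om.sig) :
    InstanceState R Om (p.subst α) σ c :=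
  ⟨hσ, hσo, EqTheory.sat_subst.2 h.sat, by
    have := h.state
    rw [← Term.subst_comp] at this
    exact this⟩

/-- All-paths satisfaction of `F` for the transition sequences of length `n`, where the parameters
are instantiated together with the other variables of the precondition. -/
def HoldsAt (R : RewriteTheory Sg) (Om : EqTheory Sg) (T : List (Pattern Sg St)) (F : RFormula Sg St)
    (n : ℕ) : Prop :=
  ∀ (c : ℕ → Set (Term Sg St)) (σ : Subst Sg), (∀ i < n, R.Trans (c i) (c (i + 1))) →
    InstanceState R Om F.pre σ (c 0) → c n ∈ semOr R Om T →
    ∃ k ≤ n, ∃ q ∈ F.post, ∃ τ, InstanceState R Om q τ (c k) ∧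
      ∀ s m, (s, m) ∈ F.params → τ s m = σ s m

theorem models_of_holdsAt (hR : R.IsRewriteTheory) (hc : R.eqTheory.ConstructorDecomposition Om)
    {T : List (Pattern Sg St)} {F : RFormula Sg St} (h : ∀ n, HoldsAt R Om T F n) :
    Models R Om T F := by
  intro ρ hρ n c htr h0 hn
  have hρo : ρ.Over Om.sig := fun s m => by
    by_cases hx : (s, m) ∈ F.params
    · exact (hρ.1 s m hx).2
    · rw [hρ.2 s m hx]
      trivial
  obtain ⟨σ, hσ⟩ := exists_instanceState_of_mem_sem h0
  -- On the parameters `ρ.comp σ` takes the ground values of `ρ`, so `τ` agrees with `ρ` there;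
  -- elsewhere `ρ` is the identity. Hence `τ` and `ρ.comp τ` coincide, and `τ` also witnesses the
  -- pattern instantiated by `ρ`.
  obtain ⟨k, hk, q, hq, τ, hτ, hag⟩ := h n c _ htr (instanceState_subst hρo hσ) hn
  refine ⟨k, hk, q.subst ρ, List.mem_map.2 ⟨q, hq, rfl⟩, ?_⟩
  refine InstanceState.mem_sem (σ := τ) hc (InstanceState.subst ?_ hτ.ground hτ.isOver)
  refine hτ.congr hR (hτ.ground.comp ρ) (hρo.comp hτ.isOver) fun s m _ => ?_
  by_cases hx : (s, m) ∈ F.params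
  · rw [hag s m hx, Subst.comp, Subst.comp, (hρ.1 s m hx).1.subst_eq, (hρ.1 s m hx).1.subst_eq]
    exact RewriteTheory.eqEB_refl _
  · rw [Subst.comp, hρ.2 s m hx]
    exact RewriteTheory.eqEB_refl _

theorem sat_strengthen {σ : Subst Sg} {φ : QF Sg} {M : List (Pattern Sg St × Subst Sg)}
    (h : R.eqTheory.Sat σ φ) (hM : ∀ m ∈ M, ¬ R.eqTheory.Sat σ (m.1.cond.subst m.2)) :
    R.eqTheory.Sat σ (strengthen φ M) := by
  induction M with
  | nil => exact h
  | cons m M ih =>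
    exact ⟨ih fun m' hm' => hM m' (List.mem_cons_of_mem _ hm'), hM m List.mem_cons_self⟩

/-- A matched disjunct of the postcondition whose condition holds is reached immediately. -/
theorem IsMatch.instanceState (hR : R.IsRewriteTheory)
    (hc : R.eqTheory.ConstructorDecomposition Om) {F : RFormula Sg St} {p : Pattern Sg St}
    {β σ : Subst Sg} {c : Set (Term Sg St)} (h : IsMatch Om F p β)
    (hσ : InstanceState R Om F.pre σ c) (hs : R.eqTheory.Sat σ (p.cond.subst β)) :
    InstanceState R Om p (β.comp σ) c ∧ ∀ s m, (s, m) ∈ F.params → β.comp σ s m = σ s m := by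
  obtain ⟨-, hβ, hid, heq⟩ := h
  refine ⟨⟨hσ.ground.comp β, hβ.comp hσ.isOver, EqTheory.sat_subst.1 hs, ?_⟩, fun s m hx => ?_⟩
  · have h1 := ProvEq.subst hσ.isOver heq
    rw [Term.subst_comp] at h1
    have h2 := h1.isOver
    exact hσ.state.of_eqEB hR.convergent ((hc.eqEB_iff hR.convergent h2.1 h2.2).1 h1)
  -- Parameters lie in the precondition, whose variables `β` does not move.
  · rw [Subst.comp, hid s m fun hx' => hx'.2 hx.1]
    rfl

theorem piecewise_conj_eq {D : Set (Var Sg)} {π : Renaming Sg} {σ τ : Subst Sg} {s : Sg.Srt}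
    {n : ℕ} (h : (s, π s n) ∉ D) :
    π.toSubst.comp (Subst.piecewise D σ (π.conj τ)) s n = τ s n := by
  rw [Renaming.toSubst_comp]
  simp only [Subst.piecewise_notMem h, Renaming.conj, Equiv.symm_apply_apply]

/-- Since the renamed pattern avoids `D`, a single substitution can serve both the goal, through `σ`
on `D`, and the pattern, through `τ` transported along the renaming. -/
theorem InstanceState.rename (hR : R.IsRewriteTheory) {D : Set (Var Sg)} {π : Renaming Sg}
    {σ τ : Subst Sg} {p : Pattern Sg St} {c : Set (Term Sg St)} (hσ : σ.IsGround)
    (hσo : σ.Over Om.sig) (h : InstanceState R Om p τ c) (hD : Disjoint (p.subst π.toSubst).vars D) :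
    InstanceState R Om (p.subst π.toSubst) (Subst.piecewise D σ (π.conj τ)) c := by
  have hg : (Subst.piecewise D σ (π.conj τ)).IsGround :=
    hσ.piecewise fun s n => h.ground s _
  have ho : (Subst.piecewise D σ (π.conj τ)).Over Om.sig := hσo.piecewise fun s n => h.isOver s _
  refine InstanceState.subst (h.congr hR (hg.comp _) ((π.toSubst_over _).comp ho) ?_) hg ho
  intro s n hx
  rw [piecewise_conj_eq (Set.disjoint_left.1 hD (Renaming.mem_vars_subst_pattern hx))]
  exact RewriteTheory.eqEB_refl _

theorem InstanceState.piecewise_left (hR : R.IsRewriteTheory) {D : Set (Var Sg)} {σ τ : Subst Sg}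
    {p : Pattern Sg St} {c : Set (Term Sg St)} (h : InstanceState R Om p σ c) (hτ : τ.IsGround)
    (hτo : τ.Over Om.sig) (hD : p.vars ⊆ D) :
    InstanceState R Om p (Subst.piecewise D σ τ) c := by
  refine h.congr hR (h.ground.piecewise hτ) (h.isOver.piecewise hτo) fun s n hx => ?_
  rw [Subst.piecewise_mem (hD hx)]
  exact RewriteTheory.eqEB_refl _

/-- A transition from an instance of the precondition applies a rule to an instance by a ground
constructor substitution of the left-hand side. -/
theorem exists_rule_instance (hR : R.IsRewriteTheory) (htop : R.IsTopmost Om St)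
    {t : Term Sg St} (htg : t.IsGround) {c d : Set (Term Sg St)}
    (hc : R.eqTheory.HasState t c) (h : R.Trans c d) :
    ∃ r ∈ R.rules St, ∃ τ : Subst Sg, R.eqTheory.EqEB t (r.lhs.subst τ) ∧
      InstanceState R Om ⟨r.rhs, r.cond⟩ τ d := by
  have hcd := htop.constructorDecomposition
  obtain ⟨n, hn, rfl⟩ := hc
  obtain ⟨a, a', b, -, -, hca, hst, hb, rfl⟩ := h
  -- The transition may start from another representative `a` of the state; closure of ground
  -- constructor terms under `B`-equality makes `a` a constructor term, so the topmost property
  -- applies.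
  have hna : R.eqTheory.EqB n a := EqTheory.eqB_of_cls_eq hca a.over_full
  obtain ⟨hng, hno⟩ := hcd.sufficientlyComplete.nf_mem _ _ _ htg t.over_full hn
  have hao := (hcd.sufficientlyComplete.closed _ _ _ hng hno hna).2
  obtain ⟨r, hr, σ, hσ, hB, hs, rfl⟩ := htop.rStep_root hao hst
  obtain ⟨τ, hτ, hτo, hστ⟩ := RewriteTheory.exists_constructor_subst hR hcd hσ
  refine ⟨r, hr, τ, ?_, hτ, hτo, (RewriteTheory.sat_congr fun s n _ => hστ s n).1 hs, ?_⟩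
  · exact (hn.1.eqEB t.over_full).trans ((EqTheory.EqB.eqEB hna).trans
      ((EqTheory.EqB.eqEB hB).trans (ProvEq.subst_pointwise r.lhs.over_full fun s n _ => hστ s n)))
  · exact EqTheory.HasState.of_eqEB hR.convergent ⟨b, hb, rfl⟩
      (ProvEq.subst_pointwise r.rhs.over_full fun s n _ => hστ s n)

/-- A state of the postcondition of `F` instantiated by `α` is a state of the postcondition of `F`,
for an instantiation of the parameters of `F` that factors through `α`. -/
theorem mem_post_of_subst (hR : R.IsRewriteTheory) {F : RFormula Sg St} {q : Pattern Sg St}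
    (hq : q ∈ F.post) {α ρ σ τ : Subst Sg} {c : Set (Term Sg St)} (hα : α.Over Om.sig)
    (hσ : σ.IsGround) (hσo : σ.Over Om.sig)
    (hρ : ∀ s n, (s, n) ∈ F.params → R.eqTheory.EqEB (σ s n) ((α s n).subst ρ))
    (hτ : InstanceState R Om (q.subst α) τ c)
    (hag : ∀ s n, (s, n) ∈ (F.pre.subst α).vars ∩ patVars (F.post.map fun p => p.subst α) →
      τ s n = ρ s n) :
    ∃ q ∈ F.post, ∃ τ', InstanceState R Om q τ' c ∧
      ∀ s m, (s, m) ∈ F.params → τ' s m = σ s m := by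
  -- Factoring through `α` recovers `σ` only up to equality in the theory, while agreement on
  -- parameters is literal; so the values on the parameters are overwritten by those of `σ`.
  refine ⟨q, hq, Subst.piecewise F.params σ (α.comp τ), ?_, fun s m hx => Subst.piecewise_mem hx⟩
  refine (instanceState_subst hα hτ).congr hR (hσ.piecewise (hτ.ground.comp α))
    (hσo.piecewise (hα.comp hτ.isOver)) fun s m _ => ?_
  by_cases hx : (s, m) ∈ F.params
  · rw [Subst.piecewise_mem hx]
    have : α.comp τ s m = (α s m).subst ρ := Term.subst_congr fun s' m' hx' =>
      hag s' m' ⟨Pattern.mem_vars_subst.2 ⟨s, m, hx.1, hx'⟩,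
        mem_patVars_map_subst.2 ⟨s, m, hx.2, hx'⟩⟩
    rw [this]
    exact (hρ s m hx).symm
  · rw [Subst.piecewise_notMem hx]
    exact RewriteTheory.eqEB_refl _

/-- Soundness of `Derives` for the transition sequences of length at most `n`, if the axioms hold
for these and the circularities for the shorter ones. -/
theorem Derives.holdsAt (hR : R.IsRewriteTheory) (htop : R.IsTopmost Om St)
    (hrhs : ∀ r ∈ R.rules St, r.rhs.Over Om.sig) {T : List (Pattern Sg St)}
    (hT : ∀ p ∈ T, p.term.Over Om.sig) {A C : Set (RFormula Sg St)} {F : RFormula Sg St}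
    (h : Derives R Om T A C F) :
    F.pre.term.Over Om.sig → (∀ G ∈ A ∪ C, ∀ q ∈ G.post, q.term.Over Om.sig) →
    ∀ n, (∀ m ≤ n, ∀ G ∈ A, HoldsAt R Om T G m) → (∀ m < n, ∀ G ∈ C, HoldsAt R Om T G m) →
    HoldsAt R Om T F n := by
  have hcd := htop.constructorDecomposition
  induction h with
  | step A C F M φ' ren U hM hφ' hdis hU hTu hpar _ ih =>
    intro hF hAC n hA hC c σ htr h0 hn
    -- Subsumption: a matched disjunct whose condition holds is met at index `0`; if there is none,
    -- `σ` satisfies the strengthened condition `φ'`.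
    by_cases hm : ∃ m ∈ M, R.eqTheory.Sat σ (m.1.cond.subst m.2)
    · obtain ⟨m, hmM, hs⟩ := hm
      obtain ⟨h1, h2⟩ := (hM m hmM).instanceState hR hcd h0 hs
      exact ⟨0, Nat.zero_le _, m.1, (hM m hmM).1, _, h1, h2⟩
    · have hs' : R.eqTheory.Sat σ φ' := by
        rw [hφ']
        exact sat_strengthen h0.sat fun m hmM hs => hm ⟨m, hmM, hs⟩
      have h0' : InstanceState R Om ⟨F.pre.term, φ'⟩ σ (c 0) := ⟨h0.ground, h0.isOver, hs', h0.state⟩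
      set D := RFormula.vars ⟨⟨F.pre.term, φ'⟩, F.post⟩ with hD
      have hpreD : Pattern.vars ⟨F.pre.term, φ'⟩ ⊆ D := Set.subset_union_left
      cases n with
      | zero =>
        -- The first state is also the last and lies in `⟦T⟧`: the glued substitution unifies `u`
        -- with a renamed disjunct of `T`, which contradicts the unsatisfiability condition.
        obtain ⟨t, ht, hct⟩ := hn
        obtain ⟨τ, hτ⟩ := exists_instanceState_of_mem_sem hct
        obtain ⟨π, V, hdisj, hV, hunsat⟩ := hTu t ht
        have hτ' := hτ.rename hR h0.ground h0.isOver hdisj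
        have hσ' := h0'.piecewise_left (τ := π.conj τ) hR (fun s n => hτ.ground s _)
          (fun s n => hτ.isOver s _) hpreD
        obtain ⟨γ, hγ, -, ρ, hρ, -, hinst⟩ := RewriteTheory.exists_ground_instance hR hcd hF
          ((hT t ht).subst (π.toSubst_over _)) hV hτ'.ground hτ'.isOver
          (hσ'.state.eqEB hτ'.state (Term.over_full _) (Term.over_full _))
        refine absurd ⟨ρ, hρ, fun s n => Term.over_full _, ?_⟩ (hunsat γ hγ)
        refine EqTheory.sat_subst.2 ⟨?_, ?_⟩
        · exact (RewriteTheory.sat_congr fun s n hx =>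
            hinst s n (Or.inl (hpreD (Or.inr hx)))).1 hσ'.sat
        · exact (RewriteTheory.sat_congr fun s n hx => hinst s n (Or.inr (Or.inr hx))).1 hτ'.sat
      | succ n =>
        obtain ⟨r, hr, τ, hlhs, hτ⟩ := exists_rule_instance hR htop
          (Term.isGround_subst h0.ground _) h0.state (htr 0 n.succ_pos)
        set r' := r.subst (ren r).toSubst with hr'
        have hdisj : Disjoint r'.vars D := hdis r hr
        have hτ' : InstanceState R Om ⟨r'.rhs, r'.cond⟩ (Subst.piecewise D σ ((ren r).conj τ))
            (c 1) := by
          refine hτ.rename hR h0.ground h0.isOver (hdisj.mono_left ?_)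
          exact Set.union_subset_union_left _ Set.subset_union_right
        have hσ' := h0'.piecewise_left (τ := (ren r).conj τ) hR (fun s n => hτ.ground s _)
          (fun s n => hτ.isOver s _) hpreD
        have hl : r'.lhs.subst (Subst.piecewise D σ ((ren r).conj τ)) = r.lhs.subst τ := by
          rw [hr', RwRule.subst, Term.subst_comp]
          refine Term.subst_congr fun s m hx => piecewise_conj_eq fun hx' => ?_
          refine Set.disjoint_left.1 hdisj (Or.inl (Or.inl ?_)) hx'
          exact Term.mem_vars_subst.2 ⟨s, m, hx, Term.mem_vars_var.2 rfl⟩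
        have hl' : F.pre.term.subst (Subst.piecewise D σ ((ren r).conj τ)) =
            F.pre.term.subst σ :=
          Term.subst_congr fun s m hx => Subst.piecewise_mem (hpreD (Or.inl hx))
        obtain ⟨α, hα, hαo, ρ, hρ, hρo, hinst⟩ := RewriteTheory.exists_ground_instance hR hcd hF
          ((htop.lhs_over r hr).subst ((ren r).toSubst_over _)) (hU r hr) hτ'.ground hτ'.isOver
          (by rw [hl']; exact hl ▸ hlhs)
        have hpre : InstanceState R Om
            (Pattern.subst ⟨r'.rhs, .and φ' r'.cond⟩ α) ρ (c 1) := by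
          have h1 : InstanceState R Om ⟨r'.rhs, .and φ' r'.cond⟩
              (Subst.piecewise D σ ((ren r).conj τ)) (c 1) :=
            ⟨hτ'.ground, hτ'.isOver, ⟨hσ'.sat, hτ'.sat⟩, hτ'.state⟩
          refine (h1.congr hR (hρ.comp α) (hαo.comp hρo) fun s m hx => hinst s m ?_).subst hρ hρo
          rcases hx with hx | hx | hx
          · exact Or.inr (Or.inl (Or.inr hx))
          · exact Or.inl (hpreD (Or.inr hx))
          · exact Or.inr (Or.inr hx)
        have hsat : R.eqTheory.Satisfiable ((QF.and φ' r'.cond).subst α) :=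
          ⟨ρ, hρ, fun s n => Term.over_full _, hpre.sat⟩
        -- The premise is used for the path without its first state. Its length is one less, so the
        -- strict bound for the circularities becomes the weak bound required of axioms.
        obtain ⟨k, hk, q, hq, τ', hτk, hag⟩ := ih r hr α hα hsat
          (((hrhs r hr).subst ((ren r).toSubst_over _)).subst hαo)
          (by simpa using hAC) n
          (fun m hm G hG => hG.elim (hA m (hm.trans n.le_succ) G)
            (hC m (Nat.lt_succ_of_le hm) G))
          (fun _ _ _ hG => hG.elim) (fun i => c (i + 1)) ρ
          (fun i hi => htr (i + 1) (Nat.succ_lt_succ hi)) hpre hn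
        obtain ⟨q, hqF, rfl⟩ := List.mem_map.1 hq
        refine ⟨k + 1, Nat.succ_le_succ hk, ?_⟩
        have hparD : F.params ⊆ D := fun x hx => Or.inr hx.2
        refine mem_post_of_subst hR hqF hαo h0.ground h0.isOver (fun s m hx => ?_) hτk
          fun s m hx => hag s m ?_
        · have h1 := hinst s m (Or.inl (hparD hx))
          rwa [Subst.piecewise_mem (hparD hx)] at h1
        · rw [hpar r hr α hα hsat] at hx
          exact hx
  | axiomRule A F F' π α hF' hdis hα hid hfresh heq hent hpar _ ih =>
    intro hF hAC n hA hC c σ htr h0 hn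
    have h1 : InstanceState R Om F'.pre (π.toSubst.comp (α.comp σ)) (c 0) := by
      refine instanceState_subst (π.toSubst_over _) (instanceState_subst hα
        ⟨h0.ground, h0.isOver, hent σ h0.ground (fun s n => Term.over_full _) h0.sat, ?_⟩)
      have h2 := ProvEq.subst h0.isOver heq
      exact h0.state.of_eqEB hR.convergent ((hcd.eqEB_iff hR.convergent h2.isOver.1 h2.isOver.2).1 h2)
    obtain ⟨k, hk, q, hq, τ, hτ, hag⟩ := hA n le_rfl F' hF' c _ htr h1 hn
    set D := (F'.subst π.toSubst).vars with hD
    have hτg : (π.conj τ).IsGround := fun s n => hτ.ground s _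
    have hτo : (π.conj τ).Over Om.sig := fun s n => hτ.isOver s _
    -- The answer of the axiom may choose new values for the variables occurring only in its
    -- postcondition, so `ρ` follows `τ` on the renamed axiom and `σ` elsewhere, in particular on
    -- the goal.
    set ρ := Subst.piecewise D (π.conj τ) σ with hρ
    have hρg : ρ.IsGround := hτg.piecewise h0.ground
    have hρo : ρ.Over Om.sig := hτo.piecewise h0.isOver
    have hρσ : ∀ s m, (s, m) ∈ F.vars → ρ s m = σ s m := fun s m hx =>
      Subst.piecewise_notMem fun hx' => Set.disjoint_left.1 hdis hx' hx
    have hqπ : q.subst π.toSubst ∈ (F'.subst π.toSubst).post := List.mem_map.2 ⟨q, hq, rfl⟩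
    have hinst : InstanceState R Om ((q.subst π.toSubst).subst α) ρ (c k) := by
      refine InstanceState.subst (InstanceState.subst (hτ.congr hR ((hρg.comp α).comp _)
        ((π.toSubst_over _).comp (hα.comp hρo)) fun s m hx => ?_) (hρg.comp α) (hα.comp hρo))
        hρg hρo
      have hxπ : (s, π s m) ∈ patVars (F'.subst π.toSubst).post :=
        ⟨_, hqπ, Renaming.mem_vars_subst_pattern hx⟩
      suffices hx' : (α s (π s m)).subst ρ = τ s m by
        rw [Renaming.toSubst_comp]
        change R.eqTheory.EqEB _ ((α s (π s m)).subst ρ)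
        rw [hx']
        exact RewriteTheory.eqEB_refl _
      -- A variable also in the precondition of the axiom is a parameter: `τ` gives it the
      -- `σ`-instance of its image under `α`, and that image avoids `D`, where alone `ρ` may differ
      -- from `σ`. Any other variable is fixed by `α`, and `ρ` follows `τ`.
      by_cases hp : (s, π s m) ∈ (F'.subst π.toSubst).pre.vars
      · have hp' : (s, m) ∈ F'.pre.vars := by
          obtain ⟨s', m', h, h'⟩ := Pattern.mem_vars_subst.1 hp
          obtain ⟨rfl, h''⟩ := Prod.mk.inj (Term.mem_vars_var.1 h')
          rwa [(π s).injective h'']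
        rw [hag s m ⟨hp', q, hq, hx⟩, Renaming.toSubst_comp]
        refine Term.subst_congr fun s' m' hx' => Subst.piecewise_notMem fun hxD => ?_
        exact Set.disjoint_left.1 (hfresh s _ hp) hx' hxD
      · rw [hid s _ hp]
        change ρ s (π s m) = τ s m
        rw [hρ, Subst.piecewise_mem (Or.inr hxπ), Renaming.conj, Equiv.symm_apply_apply]
    have hsat : R.eqTheory.Sat ρ F.pre.cond := (RewriteTheory.sat_congr fun s m hx => by
      rw [hρσ s m (Or.inl (Or.inr hx))]
      exact RewriteTheory.eqEB_refl _).1 h0.sat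
    -- The index `k` may be `0`, leaving the path at full length; this is why axioms are assumed at
    -- length `n` itself.
    obtain ⟨k', hk', p, hp, τ', hτ', hag'⟩ := ih _ hqπ
      (((hAC F' (Or.inl hF') q hq).subst (π.toSubst_over _)).subst hα) hAC (n - k)
      (fun m hm => hA m (hm.trans (Nat.sub_le n k))) (fun _ _ _ hG => hG.elim)
      (fun i => c (k + i)) ρ (fun i hi => htr (k + i) (by omega))
      ⟨hρg, hρo, ⟨hsat, hinst.sat⟩, hinst.state⟩
      (by rwa [Nat.add_sub_cancel' hk])
    refine ⟨k + k', by omega, p, hp, τ', hτ', fun s m hx => ?_⟩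
    rw [hag' s m (by
      have := hpar _ hqπ
      rw [RFormula.params] at hx ⊢
      rwa [this] at hx), hρσ s m (Or.inl hx.1)]

end Soundness

end CRL

-- Induction on the length of transition sequences

theorem mainTheorem1 {Sg : Signature.{u, v}} (R : RewriteTheory Sg) (Om : EqTheory Sg)
    (St : Sg.Srt) (hR : R.IsRewriteTheory) (htop : R.IsTopmost Om St)
    (hrhs : ∀ r ∈ R.rules St, r.rhs.Over Om.sig)
    (T : List (Pattern Sg St))
    (hT : ∀ p ∈ T, p.term.Over Om.sig ∧ p.cond.vars ⊆ p.term.vars)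
    (hTerm : semOr R Om T ⊆ R.Terminating St)
    (C : Set (RFormula Sg St)) (hfin : C.Finite) (hC : ∀ F ∈ C, F.WellFormed Om.sig)
    (hder : ∀ F ∈ C, Derives R Om T ∅ C F) :
    ∀ F ∈ C, Models R Om T F := by
  have key : ∀ n, ∀ F ∈ C, HoldsAt R Om T F n := fun n => by
    induction n using Nat.strong_induction_on with
    | _ n ih =>
      -- There are no axioms initially, and the circularities for shorter paths are exactly the
      -- induction hypothesis.
      exact fun F hF => (hder F hF).holdsAt hR htop hrhs (fun p hp => (hT p hp).1) (hC F hF).1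
        (fun G hG => hG.elim (fun h => h.elim) fun h => (hC G h).2.1) n
        (fun _ _ _ hG => hG.elim) ih
  exact fun F hF => models_of_holdsAt hR htop.constructorDecomposition fun n => key n F hF
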